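/- Let $N \ge 2$ and let $A, B > 0$. There exists a constant $C > 0$, depending only on $A$, $B$ and $N$, with the following property. Let $K \in C^{2}(\mathbb{R}^{N} \setminus \{0\})$ be a real-valued function such that $$|K(x)| \le \frac{A}{|x|^{N-1}} \quad\text{and}\quad |D^{2}K(x)| \le \frac{B}{|x|^{N+1}} \qquad \text{for every } x \in \mathbb{R}^{N} \setminus \{0\},$$ and let $\mu$ be a finite signed Borel measure in $\mathbb{R}^{N}$. Then $K * \mu(x) = \int_{\mathbb{R}^N} K(x-y) \, d\mu(y)$ is well defined for almost every $x \in \mathbb{R}^{N}$, in the sense that $\int_{\mathbb{R}^N} |K(x-y)| \, d|\mu|(y) < \infty$, and $K * \mu$ is approximately differentiable almost everywhere in $\mathbb{R}^{N}$. Its approximate derivative $\operatorname{ap} D(K*\mu)$ is Lebesgue measurable and satisfies $$[\operatorname{ap} D(K * \mu)]_{L^{1}_{\mathrm{w}}(\mathbb{R}^{N})} \le C \, \|\mu\|_{\mathcal{M}(\mathbb{R}^{N})}.$$ Here "almost everywhere" refers to Lebesgue measure, $|E|$ denotes the Lebesgue measure of $E$, $\|\mu\|_{\mathcal{M}(\mathbb{R}^{N})}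 = |\mu|(\mathbb{R}^{N})$ is the total variation, and $[f]_{L^{1}_{\mathrm{w}}(\mathbb{R}^{N})} = \sup_{t > 0} t \, |\{|f| > t\}|$. A function $v$ has approximate limit $c$ at $y$ if $\lim_{r \to 0} |\{|v - c| > \epsilon\} \cap B_{r}(y)| / |B_{r}(y)| = 0$ for every $\epsilon > 0$. It is approximately differentiable at $y$, with approximate derivative the linear map $\operatorname{ap} D v(y)$, if $\bigl(v(x) - v(y) - \operatorname{ap} D v(y)[x-y]\bigr)/|x-y|$ has approximate limit $0$ as $x \to y$. -/

import Mathlib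

open MeasureTheory Set Filter Topology
open scoped ENNReal

/-- Euclidean space `ℝᴺ`. -/
abbrev RN (N : ℕ) : Type := EuclideanSpace ℝ (Fin N)

/-- `c` is the approximate limit of `v` at `y`: for every `ε > 0` the set `{|v - c| > ε}` has
Lebesgue density zero at `y`. -/
def HasApLim {N : ℕ} {F : Type*} [NormedAddCommGroup F] (v : RN N → F) (c : F) (y : RN N) : Prop :=
  ∀ ε : ℝ, 0 < ε →
    Tendsto (fun r : ℝ =>
        volume ({x : RN N | ε < ‖v x - c‖} ∩ Metric.ball y r) / volume (Metric.ball y r))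
      (𝓝[>] 0) (𝓝 0)

/-- The linear map `L` is an approximate derivative of `v` at `y`. -/
def HasApDerivAt {N : ℕ} {F : Type*} [NormedAddCommGroup F] [NormedSpace ℝ F]
    (v : RN N → F) (L : RN N →L[ℝ] F) (y : RN N) : Prop :=
  HasApLim (fun x => ‖x - y‖⁻¹ • (v x - v y - L (x - y))) 0 y

/-- `v` is approximately differentiable at `y`. -/
def ApDifferentiableAt {N : ℕ} {F : Type*} [NormedAddCommGroup F] [NormedSpace ℝ F]
    (v : RN N → F) (y : RN N) : Prop :=
  ∃ L : RN N →L[ℝ] F, HasApDerivAt v L y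

open Classical in
/-- The approximate derivative of `v` at `y` (zero where it does not exist). -/
noncomputable def apDeriv {N : ℕ} {F : Type*} [NormedAddCommGroup F] [NormedSpace ℝ F]
    (v : RN N → F) (y : RN N) : RN N →L[ℝ] F :=
  if h : ApDifferentiableAt v y then h.choose else 0

/-- The weak-`L¹` (Marcinkiewicz) quasinorm `sup {t |{|f| > t}| : t > 0}`. -/
noncomputable def weakL1Quasinorm {N : ℕ} {F : Type*} [NormedAddCommGroup F]
    (f : RN N → F) : ℝ≥0∞ :=
  ⨆ (t : ℝ) (_ : 0 < t), ENNReal.ofReal t * volume {x : RN N | t < ‖f x‖}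

/-- The set of points `x` at which `∫ |K(x - y)| d|μ|(y)` is finite. -/
def convDom {N : ℕ} (K : RN N → ℝ) (μ : SignedMeasure (RN N)) : Set (RN N) :=
  {x | ∫⁻ y, ‖K (x - y)‖ₑ ∂μ.variation < ∞}

/-- The convolution `(K * μ)(x) = ∫ K(x - y) dμ(y)`, meaningful for `x ∈ convDom K μ`. -/
noncomputable def convMeasure {N : ℕ} (K : RN N → ℝ) (μ : SignedMeasure (RN N)) (x : RN N) : ℝ :=
  ∫ᵛ y, K (x - y) ∂<•μ

/-- `K` is of class `C²` in `ℝᴺ \ {0}` and satisfies there `|K(x)| ≤ A / |x|ᴺ⁻¹` and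
`|D²K(x)| ≤ B / |x|ᴺ⁺¹`. Nothing is asked of the value `K 0`. -/
structure IsAdmissibleKernel {N : ℕ} (A B : ℝ) (K : RN N → ℝ) : Prop where
  contDiffOn : ContDiffOn ℝ 2 K {0}ᶜ
  bound : ∀ x : RN N, x ≠ 0 → |K x| ≤ A / ‖x‖ ^ (N - 1)
  bound_hessian : ∀ x : RN N, x ≠ 0 → ‖fderiv ℝ (fderiv ℝ K) x‖ ≤ B / ‖x‖ ^ (N + 1)

/-!
The theorem follows from a Lusin–Lipschitz estimate: for every `t > 0` the function `u = K * μ` is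
`t`-Lipschitz on a set `E` with `|Eᶜ| ≤ C ‖μ‖ / t` (`exists_convMeasure_lipschitzOnWith`).
A Lipschitz extension from `E` is differentiable almost everywhere by Rademacher's theorem, and at
density points of `E` its derivative is the approximate derivative of `u`, of norm at most `t`.
Hence `|{|ap Du| > t}| ≤ C ‖μ‖ / t`, and letting `t → ∞` gives approximate differentiability almost
everywhere; this is `apDeriv_of_lusin_lipschitz`.

For the Lusin–Lipschitz estimate it is enough to treat a finite positive measure `ν`
(`exists_potential_lipschitz`). A Calderón–Zygmund decomposition at height comparable to `t`
(`exists_czDecomposition`) replaces `ν` by a good measure `g` with density `O(t)` and leaves a bad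
part with mean zero on disjoint cells inside balls of total measure `O(ν(ℝᴺ) / t)`.

*Bad part.* The bounds on `K` and `D²K` control the first and mixed second differences of `K`
(`IsAdmissibleKernel.hasKernelBounds`). By the cancellation on the cells, off the enlarged balls the
differences of the bad potential at `x` and `x'` are at most a multiple of
`|x - x'| (H(x) + H(x'))`, where `H` is a Marcinkiewicz-type function whose integral is
`O(ν(ℝᴺ))` (`CZDecomposition.enorm_integral_sub_integral_good_le`), and Chebyshev's inequality
applies to `H`.

*Good part.* The potential of `g` satisfies two translation estimates. Since the second differences
of `K` have integral `O(|a|)`, it lies in the Zygmund class, with constant `O(t)`. The same bound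
shows that the first difference `K(· + h) - K` has Fourier transform `O(|h|)`, so by Plancherel the
first differences of the potential are `O(|h|)` in `L²`, with constant `O((t ν(ℝᴺ))^(1/2))`. A
function `v` with both properties is `O(t)`-Lipschitz off a set of measure `O(ν(ℝᴺ) / t)`: if
`|v(x + a) - v(x)|` is much larger than `t |a|`, the Zygmund condition makes the difference of `v`
with step `a + b` or `a - b` large at every base point `z`, for all `z`, `b` with `|z - x| ≤ |a|`
and `|b| ≤ |a|`, and a covering argument compares this with the `L²` bound
(`volume_large_difference_le`). No singular integral operator appears.
-/

/-! ### Approximate derivatives and the Lusin–Lipschitz property -/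

section ApproximateDerivative

variable {N : ℕ} {F : Type*} [NormedAddCommGroup F] [NormedSpace ℝ F]

/-- If `v` agrees with a function differentiable at `y` on a set whose complement has density zero
at `y`, then `v` is approximately differentiable at `y`. -/
theorem hasApDerivAt_of_eqOn {v g : RN N → F} {L : RN N →L[ℝ] F} {y : RN N} {E : Set (RN N)}
    (hy : y ∈ E) (hE : EqOn v g E) (hg : HasFDerivAt g L y)
    (hd : Tendsto (fun r : ℝ => volume (Eᶜ ∩ Metric.ball y r) / volume (Metric.ball y r))
      (𝓝[>] 0) (𝓝 0)) : HasApDerivAt v L y := by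
  intro ε hε
  have h1 := (hasFDerivAt_iff_isLittleO.1 hg).def hε
  obtain ⟨δ, hδ, hb⟩ := Metric.eventually_nhds_iff_ball.1 h1
  refine tendsto_of_tendsto_of_tendsto_of_le_of_le' tendsto_const_nhds hd
    (Eventually.of_forall fun _ => zero_le) ?_
  filter_upwards [Ioo_mem_nhdsGT hδ] with r hr
  gcongr ?_ / _
  refine measure_mono fun x hx => ⟨fun hxE => ?_, hx.2⟩
  have hxb := hb x (Metric.ball_subset_ball hr.2.le hx.2)
  rw [← hE hxE, ← hE hy] at hxb
  have hx1 : ε < ‖‖x - y‖⁻¹ • (v x - v y - L (x - y)) - 0‖ := hx.1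
  rw [sub_zero, norm_smul, norm_inv, norm_norm] at hx1
  refine hx1.not_ge ?_
  rcases eq_or_ne (‖x - y‖) 0 with h0 | h0
  · simp [h0, hε.le]
  · rw [inv_mul_le_iff₀ (by positivity)]
    linarith

/-- The set where a linear map exceeds `ε` relative to the distance to `y` is a cone with vertex
`y`, so its density at `y` is its relative measure in the unit ball. Being open, it is empty as
soon as this density vanishes. -/
theorem HasApDerivAt.unique {v : RN N → F} {L₁ L₂ : RN N →L[ℝ] F} {y : RN N}
    (h₁ : HasApDerivAt v L₁ y) (h₂ : HasApDerivAt v L₂ y) : L₁ = L₂ := by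
  by_contra hne
  obtain ⟨w₀, hw₀⟩ : ∃ w, L₁ w ≠ L₂ w := by
    by_contra! h
    exact hne (ContinuousLinearMap.ext h)
  set M : RN N →L[ℝ] F := L₁ - L₂ with hM
  have hMw₀ : M w₀ ≠ 0 := by simpa [hM, sub_eq_zero] using hw₀
  have hw₀0 : w₀ ≠ 0 := by
    rintro rfl
    simp at hMw₀
  have hn : 0 < ‖w₀‖ := norm_pos_iff.2 hw₀0
  have : Nontrivial (RN N) := ⟨w₀, 0, hw₀0⟩
  set w : RN N := (2 * ‖w₀‖)⁻¹ • w₀ with hw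
  have hwn : ‖w‖ = 1 / 2 := by
    rw [hw, norm_smul, norm_inv, norm_mul, norm_norm]
    simp
    field_simp
  have hMw : 0 < ‖M w‖ := by
    rw [hw, map_smul, norm_smul]
    have h1 : 0 < ‖M w₀‖ := norm_pos_iff.2 hMw₀
    have h2 : 0 < ‖(2 * ‖w₀‖)⁻¹‖ := norm_pos_iff.2 (by positivity)
    positivity
  set ε : ℝ := ‖M w‖ / 2 with hε
  have hε0 : 0 < ε := by positivity
  set S : Set (RN N) := {x | 2 * ε * ‖x - y‖ < ‖M (x - y)‖} with hS
  have hSo : IsOpen S := isOpen_lt (by fun_prop) (by fun_prop)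
  have hwS : y + w ∈ S ∩ Metric.ball y 1 := by
    refine ⟨?_, by simp [hwn]; norm_num⟩
    simp only [hS, mem_ofPred_eq, add_sub_cancel_left, hwn]
    linarith
  have hpos : 0 < volume (S ∩ Metric.ball y 1) :=
    (hSo.inter Metric.isOpen_ball).measure_pos _ ⟨_, hwS⟩
  have hsub : ∀ r, volume (S ∩ Metric.ball y r) / volume (Metric.ball y r) ≤
      volume ({x : RN N | ε < ‖‖x - y‖⁻¹ • (v x - v y - L₁ (x - y)) - 0‖} ∩ Metric.ball y r) /
        volume (Metric.ball y r) +
      volume ({x : RN N | ε < ‖‖x - y‖⁻¹ • (v x - v y - L₂ (x - y)) - 0‖} ∩ Metric.ball y r) /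
        volume (Metric.ball y r) := by
    intro r
    rw [← ENNReal.add_div]
    gcongr
    refine le_trans (measure_mono ?_) (measure_union_le _ _)
    rw [← union_inter_distrib_right]
    refine inter_subset_inter_left _ fun x hx => ?_
    simp only [hS, mem_ofPred_eq] at hx
    by_contra hcon
    simp only [mem_union, mem_ofPred_eq, sub_zero, not_or, not_lt, norm_smul, norm_inv,
      norm_norm] at hcon
    rcases eq_or_ne (‖x - y‖) 0 with h0 | h0
    · rw [norm_eq_zero.1 h0] at hx
      simp at hx
    have hp : 0 < ‖x - y‖ := by positivity
    rw [inv_mul_le_iff₀ hp, inv_mul_le_iff₀ hp] at hcon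
    have : M (x - y) = (v x - v y - L₂ (x - y)) - (v x - v y - L₁ (x - y)) := by
      simp only [hM, sub_apply]
      abel
    have h3 := norm_sub_le (v x - v y - L₂ (x - y)) (v x - v y - L₁ (x - y))
    rw [← this] at h3
    linarith [hcon.1, hcon.2]
  have hlim : Tendsto (fun r : ℝ => volume (S ∩ Metric.ball y r) / volume (Metric.ball y r))
      (𝓝[>] 0) (𝓝 0) := by
    have := (h₁ ε hε0).add (h₂ ε hε0)
    rw [add_zero] at this
    exact tendsto_of_tendsto_of_tendsto_of_le_of_le tendsto_const_nhds this
      (fun _ => zero_le) hsub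
  have hconst : ∀ r : ℝ, 0 < r → volume (S ∩ Metric.ball y r) / volume (Metric.ball y r) =
      volume (S ∩ Metric.ball y 1) / volume (Metric.ball y 1) := by
    intro r hr
    have himg : S ∩ Metric.ball y r = AffineMap.homothety y r '' (S ∩ Metric.ball y 1) := by
      ext x
      simp only [mem_inter_iff, mem_image, Metric.mem_ball, dist_eq_norm, hS, mem_ofPred_eq,
        AffineMap.homothety_apply, vsub_eq_sub, vadd_eq_add]
      constructor
      · rintro ⟨h1, h2⟩
        refine ⟨r⁻¹ • (x - y) + y, ⟨?_, ?_⟩, ?_⟩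
        · rw [add_sub_cancel_right, map_smul, norm_smul, norm_smul]
          have : 0 < ‖r⁻¹‖ := norm_pos_iff.2 (by positivity)
          nlinarith
        · rw [add_sub_cancel_right, norm_smul, norm_inv, Real.norm_of_nonneg hr.le,
            inv_mul_lt_iff₀ hr]
          linarith
        · rw [add_sub_cancel_right, smul_smul, mul_inv_cancel₀ hr.ne', one_smul,
            sub_add_cancel]
      · rintro ⟨z, ⟨h1, h2⟩, rfl⟩
        rw [add_sub_cancel_right, map_smul, norm_smul, norm_smul, Real.norm_of_nonneg hr.le]
        constructor <;> nlinarith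
    rw [himg, Measure.addHaar_image_homothety, Measure.addHaar_ball _ _ hr.le,
      Measure.addHaar_ball_center _ y, abs_of_pos (pow_pos hr _)]
    refine ENNReal.mul_div_mul_left _ _ ?_ ENNReal.ofReal_ne_top
    simpa using pow_pos hr _
  have hlim2 : Tendsto (fun r : ℝ => volume (S ∩ Metric.ball y r) / volume (Metric.ball y r))
      (𝓝[>] 0) (𝓝 (volume (S ∩ Metric.ball y 1) / volume (Metric.ball y 1))) := by
    refine tendsto_const_nhds.congr' ?_
    filter_upwards [self_mem_nhdsWithin] with r hr using (hconst r hr).symm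
  have := tendsto_nhds_unique hlim2 hlim
  rw [ENNReal.div_eq_zero_iff] at this
  rcases this with h | h
  · exact hpos.ne' h
  · exact measure_ball_lt_top.ne h

theorem HasApDerivAt.apDeriv_eq {v : RN N → F} {L : RN N →L[ℝ] F} {y : RN N}
    (h : HasApDerivAt v L y) : apDeriv v y = L := by
  have h' : ApDifferentiableAt v y := ⟨L, h⟩
  rw [apDeriv, dif_pos h']
  exact h'.choose_spec.unique h

end ApproximateDerivative

section LusinLipschitz

variable {N : ℕ}

/-- By Rademacher's theorem and Lebesgue's density theorem, a function that is Lipschitz on a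
measurable set has at almost every point of it an approximate derivative, which is the derivative
of a Lipschitz extension. -/
theorem LipschitzOnWith.ae_hasApDerivAt (hN : 0 < N) {v : RN N → ℝ} {E : Set (RN N)} {t : NNReal}
    (hE : MeasurableSet E) (hv : LipschitzOnWith t v E) :
    ∃ g : RN N → ℝ, LipschitzWith t g ∧
      ∀ᵐ y : RN N, y ∈ E → HasApDerivAt v (fderiv ℝ g y) y := by
  obtain ⟨g, hg, hvg⟩ := hv.extend_real
  refine ⟨g, hg, ?_⟩
  have : Nonempty (Fin N) := ⟨⟨0, hN⟩⟩
  filter_upwards [hg.ae_differentiableAt,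
    Besicovitch.ae_tendsto_measure_inter_div_of_measurableSet (volume : Measure (RN N)) hE.compl]
    with y hy1 hy2 hyE
  refine hasApDerivAt_of_eqOn hyE hvg hy1.hasFDerivAt ?_
  rw [indicator_of_notMem (by simpa using hyE)] at hy2
  refine tendsto_of_tendsto_of_tendsto_of_le_of_le tendsto_const_nhds hy2
    (fun _ => zero_le) fun r => ?_
  simp only
  rw [Measure.addHaar_closedBall_eq_addHaar_ball]
  gcongr
  exact Metric.ball_subset_closedBall

/-- The Lusin–Lipschitz property with a weak-type rate: if for every `t > 0` the function `v` is
`t`-Lipschitz off a set of measure at most `m / t`, then it is approximately differentiable almost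
everywhere and its approximate derivative has weak-`L¹` quasinorm at most `m`. -/
theorem apDeriv_of_lusin_lipschitz (hN : 0 < N) {v : RN N → ℝ} {m : ℝ≥0∞} (hm : m ≠ ∞)
    (h : ∀ t : NNReal, 0 < t → ∃ E : Set (RN N), volume Eᶜ ≤ m / t ∧ LipschitzOnWith t v E) :
    (∀ᵐ y : RN N, ApDifferentiableAt v y) ∧ AEStronglyMeasurable (apDeriv v) volume ∧
      weakL1Quasinorm (apDeriv v) ≤ m := by
  have h' : ∀ t : NNReal, 0 < t → ∃ E : Set (RN N), MeasurableSet E ∧ volume Eᶜ ≤ m / t ∧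
      LipschitzOnWith t v E := by
    intro t ht
    obtain ⟨E, h1, h2⟩ := h t ht
    refine ⟨(toMeasurable volume Eᶜ)ᶜ, (measurableSet_toMeasurable _ _).compl, ?_, h2.mono ?_⟩
    · rwa [compl_compl, measure_toMeasurable]
    · exact compl_subset_comm.1 (subset_toMeasurable _ _)
  choose! E hEm hEv hEL using h'
  have h2 : ∀ t : NNReal, 0 < t → ∃ g : RN N → ℝ, LipschitzWith t g ∧
      ∀ᵐ y : RN N, y ∈ E t → HasApDerivAt v (fderiv ℝ g y) y :=
    fun t ht => (hEL t ht).ae_hasApDerivAt hN (hEm t ht)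
  choose! g hg hgE using h2
  -- the sets with Lipschitz constant `n + 1` exhaust almost everything
  have hpos : ∀ n : ℕ, (0 : NNReal) < n + 1 := fun n => by positivity
  have hcov : ∀ᵐ y : RN N, ∃ n : ℕ, y ∈ E (n + 1) := by
    rw [ae_iff]
    have hle : ∀ n : ℕ, volume {y : RN N | ¬∃ n : ℕ, y ∈ E (n + 1)} ≤ m / (n + 1 : ℕ) := by
      intro n
      refine le_trans (measure_mono ?_) (le_trans (hEv _ (hpos n)) ?_)
      · intro y hy hyE
        exact hy ⟨n, hyE⟩
      · push_cast
        rfl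
    have hl : Tendsto (fun n : ℕ => m / ((n + 1 : ℕ) : ℝ≥0∞)) atTop (𝓝 0) :=
      (tendsto_add_atTop_iff_nat (f := fun n : ℕ => m / (n : ℝ≥0∞)) 1).2 <| by
        simpa using ENNReal.Tendsto.const_div ENNReal.tendsto_nat_nhds_top (Or.inr hm)
    exact le_antisymm (ge_of_tendsto' hl hle) zero_le
  refine ⟨?_, ?_, ?_⟩
  · filter_upwards [hcov, ae_all_iff.2 fun n : ℕ => hgE (n + 1) (hpos n)] with y ⟨n, hn⟩ h3
    exact ⟨_, h3 n hn⟩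
  · have hU : AEStronglyMeasurable (apDeriv v) (volume.restrict (⋃ n : ℕ, E (n + 1))) := by
      refine (aestronglyMeasurable_iUnion_iff).2 fun n => ?_
      refine AEStronglyMeasurable.congr
        (f := fderiv ℝ (g (n + 1))) (measurable_fderiv ℝ _).aestronglyMeasurable ?_
      rw [EventuallyEq, ae_restrict_iff' (hEm _ (hpos n))]
      filter_upwards [hgE (n + 1) (hpos n)] with y hy hyE
      exact (hy hyE).apDeriv_eq.symm
    rwa [Measure.restrict_eq_self_of_ae_mem] at hU
    filter_upwards [hcov] with y hy using mem_iUnion.2 hy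
  · refine iSup₂_le fun t ht => ?_
    lift t to NNReal using ht.le
    have ht' : 0 < t := by exact_mod_cast ht
    have hle : volume {x : RN N | (t : ℝ) < ‖apDeriv v x‖} ≤ m / t := by
      refine le_trans (measure_mono_ae ?_) (hEv t ht')
      filter_upwards [hgE t ht'] with y hy hyt hyE
      have hyt' : (t : ℝ) < ‖apDeriv v y‖ := hyt
      rw [(hy hyE).apDeriv_eq] at hyt'
      exact hyt'.not_ge (norm_fderiv_le_of_lipschitz ℝ (hg t ht'))
    rw [ENNReal.ofReal_coe_nnreal]
    calc _ ≤ (t : ℝ≥0∞) * (m / t) := by gcongr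
      _ ≤ m := ENNReal.mul_div_le

end LusinLipschitz

/-! ### Finite differences of admissible kernels -/

section Kernel

variable {N : ℕ}

/-- The difference estimates that the proof extracts from an admissible kernel, with a single
constant: size, first difference, and mixed second difference. -/
structure HasKernelBounds (A : ℝ) (K : RN N → ℝ) : Prop where
  measurable : Measurable K
  size : ∀ z : RN N, z ≠ 0 → |K z| ≤ A / ‖z‖ ^ (N - 1)
  first : ∀ z a : RN N, z ≠ 0 → ‖a‖ ≤ ‖z‖ / 2 → |K (z + a) - K z| ≤ A * ‖a‖ / ‖z‖ ^ N
  mixed : ∀ z a b : RN N, z ≠ 0 → ‖a‖ + ‖b‖ ≤ ‖z‖ / 2 →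
    |K (z + a + b) - K (z + a) - (K (z + b) - K z)| ≤ A * ‖a‖ * ‖b‖ / ‖z‖ ^ (N + 1)

theorem IsAdmissibleKernel.measurable {A B : ℝ} {K : RN N → ℝ} (hK : IsAdmissibleKernel A B K) :
    Measurable K :=
  measurable_of_continuousOn_compl_singleton 0 hK.contDiffOn.continuousOn

theorem half_norm_le_of_mem_closedBall {z y : RN N} (hy : y ∈ Metric.closedBall z (‖z‖ / 2)) :
    ‖z‖ / 2 ≤ ‖y‖ := by
  have h1 : ‖y - z‖ ≤ ‖z‖ / 2 := by rwa [← dist_eq_norm]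
  have h2 := norm_sub_norm_le z y
  rw [norm_sub_rev] at h2
  linarith

theorem ne_zero_of_mem_closedBall {z y : RN N} (hz : z ≠ 0)
    (hy : y ∈ Metric.closedBall z (‖z‖ / 2)) : y ≠ 0 := by
  have := half_norm_le_of_mem_closedBall hy
  have h2 : 0 < ‖z‖ := norm_pos_iff.2 hz
  exact norm_pos_iff.1 (by linarith)

/-- A bound by a power of the distance to the origin, transported to the ball of half radius. -/
theorem div_norm_pow_le {z y : RN N} (hz : z ≠ 0) {C : ℝ} (hC : 0 ≤ C) (k : ℕ)
    (hy : ‖z‖ / 2 ≤ ‖y‖) : C / ‖y‖ ^ k ≤ C * 2 ^ k / ‖z‖ ^ k := by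
  have h2 : 0 < ‖z‖ := norm_pos_iff.2 hz
  have h3 : C * 2 ^ k / ‖z‖ ^ k = C / (‖z‖ / 2) ^ k := by
    rw [div_pow]
    field_simp
  rw [h3]
  gcongr

variable {A B : ℝ} {K : RN N → ℝ}

theorem IsAdmissibleKernel.contDiffAt (hK : IsAdmissibleKernel A B K) {z : RN N} (hz : z ≠ 0) :
    ContDiffAt ℝ 2 K z :=
  hK.contDiffOn.contDiffAt (isOpen_compl_singleton.mem_nhds hz)

theorem IsAdmissibleKernel.differentiableAt (hK : IsAdmissibleKernel A B K) {z : RN N}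
    (hz : z ≠ 0) : DifferentiableAt ℝ K z :=
  (hK.contDiffAt hz).differentiableAt (by norm_num)

theorem IsAdmissibleKernel.norm_fderiv_sub_le (hB : 0 ≤ B) (hK : IsAdmissibleKernel A B K)
    {z x y : RN N} (hz : z ≠ 0) (hx : x ∈ Metric.closedBall z (‖z‖ / 2))
    (hy : y ∈ Metric.closedBall z (‖z‖ / 2)) :
    ‖fderiv ℝ K y - fderiv ℝ K x‖ ≤ B * 2 ^ (N + 1) / ‖z‖ ^ (N + 1) * ‖y - x‖ := by
  refine (convex_closedBall z (‖z‖ / 2)).norm_image_sub_le_of_norm_fderiv_le (𝕜 := ℝ)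
    (fun w hw => ?_) (fun w hw => ?_) hx hy
  · exact ((hK.contDiffAt (ne_zero_of_mem_closedBall hz hw)).fderiv_right (m := 1)
      (by norm_num)).differentiableAt (by norm_num)
  · exact (hK.bound_hessian w (ne_zero_of_mem_closedBall hz hw)).trans
      (div_norm_pow_le hz hB _ (half_norm_le_of_mem_closedBall hw))

/-- The gradient bound interpolated between the bounds on the kernel and on its Hessian. -/
theorem IsAdmissibleKernel.norm_fderiv_le (hN : 0 < N) (hA : 0 ≤ A) (hB : 0 ≤ B)
    (hK : IsAdmissibleKernel A B K) {z : RN N} (hz : z ≠ 0) :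
    ‖fderiv ℝ K z‖ ≤ (A * 2 ^ (N + 1) + B * 2 ^ (N + 1)) / ‖z‖ ^ N := by
  have hz0 : 0 < ‖z‖ := norm_pos_iff.2 hz
  have hzz : z ∈ Metric.closedBall z (‖z‖ / 2) := Metric.mem_closedBall_self (by positivity)
  obtain ⟨n, rfl⟩ : ∃ n, N = n + 1 := ⟨N - 1, by omega⟩
  -- a first-order Taylor expansion with step `|z| / 2` balances the two bounds
  have key : ∀ h : RN (n + 1), ‖h‖ = ‖z‖ / 2 →
      ‖fderiv ℝ K z h‖ ≤ (A * 2 ^ (n + 2) + B * 2 ^ (n + 2)) / ‖z‖ ^ (n + 1) * ‖h‖ := by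
    intro h hh
    have hzh : z + h ∈ Metric.closedBall z (‖z‖ / 2) := by simp [hh]
    have h1 := (convex_closedBall z (‖z‖ / 2)).norm_image_sub_le_of_norm_fderiv_le' (𝕜 := ℝ)
      (f := K) (φ := fderiv ℝ K z) (C := B * 2 ^ (n + 2) / ‖z‖ ^ (n + 2) * (‖z‖ / 2))
      (fun w hw => hK.differentiableAt (ne_zero_of_mem_closedBall hz hw)) (fun w hw => by
        refine (hK.norm_fderiv_sub_le hB hz hzz hw).trans ?_
        gcongr
        rwa [← dist_eq_norm]) hzz hzh
    rw [add_sub_cancel_left, hh] at h1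
    have h2 : |K (z + h)| ≤ A * 2 ^ n / ‖z‖ ^ n :=
      (hK.bound _ (ne_zero_of_mem_closedBall hz hzh)).trans
        (div_norm_pow_le hz hA n (half_norm_le_of_mem_closedBall hzh))
    have h3 : |K z| ≤ A / ‖z‖ ^ n := hK.bound z hz
    have h4 : A / ‖z‖ ^ n ≤ A * 2 ^ n / ‖z‖ ^ n := by
      gcongr
      exact le_mul_of_one_le_right hA (one_le_pow₀ (by norm_num))
    rw [Real.norm_eq_abs, abs_le] at h1
    rw [Real.norm_eq_abs, abs_le, hh]
    have e1 : B * 2 ^ (n + 2) / ‖z‖ ^ (n + 2) * (‖z‖ / 2) * (‖z‖ / 2) = B * 2 ^ n / ‖z‖ ^ n := by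
      field_simp
      ring
    have e2 : (A * 2 ^ (n + 2) + B * 2 ^ (n + 2)) / ‖z‖ ^ (n + 1) * (‖z‖ / 2) =
      2 * (A * 2 ^ n / ‖z‖ ^ n) + 2 * (B * 2 ^ n / ‖z‖ ^ n) := by
      field_simp
      ring
    have e3 : 0 ≤ B * 2 ^ n / ‖z‖ ^ n := by positivity
    rw [e1] at h1
    rw [e2]
    rw [abs_le] at h2 h3
    constructor <;> linarith [h1.1, h1.2, h2.1, h2.2, h3.1, h3.2]
  refine ContinuousLinearMap.opNorm_le_bound _ (by positivity) fun v => ?_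
  rcases eq_or_ne v 0 with rfl | hv
  · simp
  have hv0 : 0 < ‖v‖ := norm_pos_iff.2 hv
  have h1 := key ((‖z‖ / 2 / ‖v‖) • v) (by
    rw [norm_smul, Real.norm_of_nonneg (by positivity)]
    field_simp)
  rw [map_smul, norm_smul, norm_smul, Real.norm_of_nonneg (by positivity), mul_left_comm] at h1
  exact le_of_mul_le_mul_left h1 (by positivity)

theorem IsAdmissibleKernel.hasKernelBounds (hN : 0 < N) (hA : 0 ≤ A) (hB : 0 ≤ B)
    (hK : IsAdmissibleKernel A B K) :
    HasKernelBounds ((A * 2 ^ (N + 1) + B * 2 ^ (N + 1)) * 2 ^ N) K where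
  measurable := hK.measurable
  size z hz := by
    refine (hK.bound z hz).trans ?_
    gcongr
    have h1 : (1 : ℝ) ≤ 2 ^ (N + 1) := one_le_pow₀ (by norm_num)
    have h2 : (1 : ℝ) ≤ 2 ^ N := one_le_pow₀ (by norm_num)
    have h3 : 0 ≤ B * 2 ^ (N + 1) := by positivity
    calc A ≤ A * 2 ^ (N + 1) := le_mul_of_one_le_right hA h1
      _ ≤ A * 2 ^ (N + 1) + B * 2 ^ (N + 1) := by linarith
      _ ≤ _ := le_mul_of_one_le_right (by positivity) h2
  first z a hz ha := by
    have hz0 : 0 < ‖z‖ := norm_pos_iff.2 hz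
    have hzz : z ∈ Metric.closedBall z (‖z‖ / 2) := Metric.mem_closedBall_self (by positivity)
    have hza : z + a ∈ Metric.closedBall z (‖z‖ / 2) := by simpa using ha
    have h1 := (convex_closedBall z (‖z‖ / 2)).norm_image_sub_le_of_norm_fderiv_le (𝕜 := ℝ)
      (f := K) (C := (A * 2 ^ (N + 1) + B * 2 ^ (N + 1)) * 2 ^ N / ‖z‖ ^ N)
      (fun w hw => hK.differentiableAt (ne_zero_of_mem_closedBall hz hw)) (fun w hw =>
        (hK.norm_fderiv_le hN hA hB (ne_zero_of_mem_closedBall hz hw)).trans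
          (div_norm_pow_le hz (by positivity) _ (half_norm_le_of_mem_closedBall hw))) hzz hza
    rw [add_sub_cancel_left, Real.norm_eq_abs] at h1
    exact h1.trans_eq (by ring)
  mixed z a b hz hab := by
    have hz0 : 0 < ‖z‖ := norm_pos_iff.2 hz
    have hs : ∀ w ∈ Metric.closedBall z ‖a‖, w ∈ Metric.closedBall z (‖z‖ / 2) ∧
        w + b ∈ Metric.closedBall z (‖z‖ / 2) := by
      intro w hw
      rw [mem_closedBall_iff_norm] at hw
      constructor
      · rw [mem_closedBall_iff_norm]
        linarith [norm_nonneg b]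
      · rw [mem_closedBall_iff_norm, add_sub_right_comm]
        linarith [norm_add_le (w - z) b]
    have hd : ∀ w ∈ Metric.closedBall z ‖a‖, HasFDerivAt (fun s => K (s + b) - K s)
        (fderiv ℝ K (w + b) - fderiv ℝ K w) w := by
      intro w hw
      have h1 := (hK.differentiableAt (ne_zero_of_mem_closedBall hz (hs w hw).1)).hasFDerivAt
      have h2 := (hK.differentiableAt (ne_zero_of_mem_closedBall hz (hs w hw).2)).hasFDerivAt
      exact ((hasFDerivAt_comp_add_right b).2 h2).sub h1
    have h1 := (convex_closedBall z ‖a‖).norm_image_sub_le_of_norm_hasFDerivWithin_le (𝕜 := ℝ)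
      (f := fun s => K (s + b) - K s) (C := B * 2 ^ (N + 1) / ‖z‖ ^ (N + 1) * ‖b‖)
      (fun w hw => (hd w hw).hasFDerivWithinAt) (fun w hw => by
        have := hK.norm_fderiv_sub_le hB hz (hs w hw).1 (hs w hw).2
        rwa [add_sub_cancel_left] at this)
      (Metric.mem_closedBall_self (norm_nonneg a)) (y := z + a) (by simp)
    rw [add_sub_cancel_left, Real.norm_eq_abs] at h1
    refine h1.trans ?_
    have h2 : B * 2 ^ (N + 1) ≤ (A * 2 ^ (N + 1) + B * 2 ^ (N + 1)) * 2 ^ N := by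
      have h2 : (1 : ℝ) ≤ 2 ^ N := one_le_pow₀ (by norm_num)
      have h3 : 0 ≤ A * 2 ^ (N + 1) := by positivity
      calc B * 2 ^ (N + 1) ≤ A * 2 ^ (N + 1) + B * 2 ^ (N + 1) := by linarith
        _ ≤ _ := le_mul_of_one_le_right (by positivity) h2
    calc _ = B * 2 ^ (N + 1) * ‖a‖ * ‖b‖ / ‖z‖ ^ (N + 1) := by ring
      _ ≤ _ := by gcongr

/-! ### Radial integrals and the second-difference bound -/

/-- The area of the unit sphere of `ℝᴺ`. -/
noncomputable def sphereArea (N : ℕ) : ℝ := N * volume.real (Metric.ball (0 : RN N) 1)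

theorem sphereArea_nonneg (N : ℕ) : 0 ≤ sphereArea N := by unfold sphereArea; positivity

/-- Integration in polar coordinates of a nonnegative radial function. -/
theorem lintegral_radial [Nontrivial (RN N)] {f : ℝ → ℝ} (hf : ∀ x, 0 ≤ f x)
    (hi : IntegrableOn (fun y : ℝ => y ^ (N - 1) * f y) (Ioi 0)) :
    ∫⁻ z : RN N, ENNReal.ofReal (f ‖z‖) =
      ENNReal.ofReal (sphereArea N * ∫ y in Ioi (0 : ℝ), y ^ (N - 1) * f y) := by
  have h1 : Integrable (fun z : RN N => f ‖z‖) := by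
    rw [integrable_fun_norm_addHaar]
    simpa using hi
  rw [← ofReal_integral_eq_lintegral_ofReal h1 (Eventually.of_forall fun z => hf _),
    integral_fun_norm_addHaar]
  simp [sphereArea, mul_assoc]

theorem lintegral_ball_inv_norm_pow [Nontrivial (RN N)] {ρ : ℝ} (hρ : 0 ≤ ρ) :
    ∫⁻ z in Metric.ball (0 : RN N) ρ, ENNReal.ofReal ((‖z‖ ^ (N - 1))⁻¹) =
      ENNReal.ofReal (sphereArea N * ρ) := by
  have hcong : EqOn (fun y : ℝ => y ^ (N - 1) * (Iio ρ).indicator (fun y => |y ^ (N - 1)|⁻¹) y)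
      ((Iio ρ).indicator fun _ => (1 : ℝ)) (Ioi 0) := by
    intro y hy
    have hy' : (0 : ℝ) < y := hy
    by_cases h : y < ρ
    · simp only [indicator, mem_Iio, h, if_true]
      rw [abs_of_pos (by positivity), mul_inv_cancel₀ (by positivity)]
    · simp [h]
  have hIio : Ioi (0 : ℝ) ∩ Iio ρ = Ioo 0 ρ := rfl
  have h := lintegral_radial (N := N)
    (f := (Iio ρ).indicator fun y => |y ^ (N - 1)|⁻¹)
    (fun x => indicator_nonneg (fun _ _ => by positivity) _) (by
      rw [integrableOn_congr_fun hcong measurableSet_Ioi]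
      rw [IntegrableOn, integrable_indicator_iff measurableSet_Iio, IntegrableOn,
        Measure.restrict_restrict measurableSet_Iio, inter_comm, hIio]
      simp)
  rw [setIntegral_congr_fun measurableSet_Ioi hcong, setIntegral_indicator measurableSet_Iio,
    hIio] at h
  simp only [integral_const, smul_eq_mul, mul_one, measureReal_restrict_apply_univ,
    Real.volume_real_Ioo_of_le hρ, sub_zero] at h
  rw [← h, ← lintegral_indicator Metric.isOpen_ball.measurableSet]
  congr 1 with z
  by_cases hz : ‖z‖ < ρ
  · simp [hz, indicator]
  · simp [hz, indicator]

theorem lintegral_compl_ball_inv_norm_pow [Nontrivial (RN N)] (hN : 0 < N) {ρ : ℝ} (hρ : 0 < ρ) :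
    ∫⁻ z in (Metric.ball (0 : RN N) ρ)ᶜ, ENNReal.ofReal ((‖z‖ ^ (N + 1))⁻¹) =
      ENNReal.ofReal (sphereArea N / ρ) := by
  obtain ⟨n, rfl⟩ : ∃ n, N = n + 1 := ⟨N - 1, by omega⟩
  have hcong : EqOn (fun y : ℝ => y ^ (n + 1 - 1) *
        (Ici ρ).indicator (fun y => |y ^ (n + 1 + 1)|⁻¹) y)
      ((Ici ρ).indicator fun y => y ^ (-2 : ℝ)) (Ioi 0) := by
    intro y hy
    have hy' : (0 : ℝ) < y := hy
    by_cases h : ρ ≤ y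
    · simp only [indicator, mem_Ici, h, if_true]
      rw [abs_of_pos (by positivity), Real.rpow_neg hy'.le]
      norm_num
      field_simp
      ring
    · simp [h]
  have hIci : Ioi (0 : ℝ) ∩ Ici ρ = Ici ρ :=
    inter_eq_right.2 fun y hy => lt_of_lt_of_le hρ hy
  have h := lintegral_radial (N := n + 1)
    (f := (Ici ρ).indicator fun y => |y ^ (n + 1 + 1)|⁻¹)
    (fun x => indicator_nonneg (fun _ _ => by positivity) _) (by
      rw [integrableOn_congr_fun hcong measurableSet_Ioi]
      rw [IntegrableOn, integrable_indicator_iff measurableSet_Ici, IntegrableOn,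
        Measure.restrict_restrict measurableSet_Ici, inter_comm, hIci,
        ← IntegrableOn, integrableOn_Ici_iff_integrableOn_Ioi]
      exact integrableOn_Ioi_rpow_of_lt (by norm_num) hρ)
  rw [setIntegral_congr_fun measurableSet_Ioi hcong, setIntegral_indicator measurableSet_Ici,
    hIci, integral_Ici_eq_integral_Ioi, integral_Ioi_rpow_of_lt (by norm_num) hρ] at h
  have e : -ρ ^ ((-2 : ℝ) + 1) / (-2 + 1) = 1 / ρ := by
    norm_num [Real.rpow_neg_one]
  rw [e, mul_one_div] at h
  rw [← h, ← lintegral_indicator Metric.isOpen_ball.measurableSet.compl]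
  congr 1 with z
  by_cases hz : ‖z‖ < ρ
  · simp [hz, indicator, not_le.2 hz]
  · simp [hz, indicator, not_lt.1 hz]

theorem lintegral_ball_enorm_le [Nontrivial (RN N)] {f : RN N → ℝ} (hA : 0 ≤ A)
    (hs : ∀ z : RN N, z ≠ 0 → |f z| ≤ A / ‖z‖ ^ (N - 1)) {ρ : ℝ} (hρ : 0 ≤ ρ) :
    ∫⁻ z in Metric.ball (0 : RN N) ρ, ‖f z‖ₑ ≤ ENNReal.ofReal (A * sphereArea N * ρ) := by
  calc ∫⁻ z in Metric.ball (0 : RN N) ρ, ‖f z‖ₑ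
      ≤ ∫⁻ z in Metric.ball (0 : RN N) ρ,
          ENNReal.ofReal A * ENNReal.ofReal ((‖z‖ ^ (N - 1))⁻¹) := by
        refine lintegral_mono_ae (ae_restrict_of_ae ?_)
        filter_upwards [Measure.ae_ne volume (0 : RN N)] with z hz
        rw [← ENNReal.ofReal_mul hA, Real.enorm_eq_ofReal_abs]
        exact ENNReal.ofReal_le_ofReal (hs z hz)
    _ = _ := by
        rw [lintegral_const_mul _ (by fun_prop), lintegral_ball_inv_norm_pow hρ,
          ← ENNReal.ofReal_mul hA, mul_assoc]

theorem lintegral_compl_ball_enorm_le [Nontrivial (RN N)] (hN : 0 < N) {f : RN N → ℝ}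
    (hA : 0 ≤ A) {ρ : ℝ} (hρ : 0 < ρ)
    (hs : ∀ z : RN N, ρ ≤ ‖z‖ → |f z| ≤ A / ‖z‖ ^ (N + 1)) :
    ∫⁻ z in (Metric.ball (0 : RN N) ρ)ᶜ, ‖f z‖ₑ ≤ ENNReal.ofReal (A * sphereArea N / ρ) := by
  calc ∫⁻ z in (Metric.ball (0 : RN N) ρ)ᶜ, ‖f z‖ₑ
      ≤ ∫⁻ z in (Metric.ball (0 : RN N) ρ)ᶜ,
          ENNReal.ofReal A * ENNReal.ofReal ((‖z‖ ^ (N + 1))⁻¹) := by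
        refine setLIntegral_mono' Metric.isOpen_ball.measurableSet.compl fun z hz => ?_
        rw [← ENNReal.ofReal_mul hA, Real.enorm_eq_ofReal_abs]
        exact ENNReal.ofReal_le_ofReal (hs z (by simpa using hz))
    _ = _ := by
        rw [lintegral_const_mul _ (by fun_prop), lintegral_compl_ball_inv_norm_pow hN hρ,
          ← ENNReal.ofReal_mul hA, mul_div_assoc]

/-- The scale-invariant form of the cancellation of the kernel: its second differences with step
`a` have `L¹` norm `O(|a|)`. -/
theorem lintegral_second_difference_le [Nontrivial (RN N)] (hN : 0 < N) {f : RN N → ℝ} (hA : 0 ≤ A)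
    (hf : Measurable f) (hs : ∀ z : RN N, z ≠ 0 → |f z| ≤ A / ‖z‖ ^ (N - 1))
    (h2 : ∀ z a : RN N, z ≠ 0 → ‖a‖ ≤ ‖z‖ / 4 →
      |f (z + a) + f (z - a) - 2 * f z| ≤ A * ‖a‖ ^ 2 / ‖z‖ ^ (N + 1)) (a : RN N) :
    ∫⁻ z, ‖f (z + a) + f (z - a) - 2 * f z‖ₑ ≤ ENNReal.ofReal (21 * A * sphereArea N * ‖a‖) := by
  rcases eq_or_ne a 0 with rfl | ha
  · simp [two_mul]
  have ha0 : 0 < ‖a‖ := norm_pos_iff.2 ha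
  have hσ := sphereArea_nonneg N
  set ρ := 4 * ‖a‖ with hρ
  have hρ0 : 0 < ρ := by positivity
  have hI := lintegral_ball_enorm_le (N := N) hA hs (ρ := 5 * ‖a‖) (by positivity)
  -- on the ball of radius `4 |a|` each of the four terms is integrated separately
  have hshift : ∀ b : RN N, ‖b‖ ≤ ‖a‖ → ∫⁻ z in Metric.ball (0 : RN N) ρ, ‖f (z + b)‖ₑ ≤
      ENNReal.ofReal (A * sphereArea N * (5 * ‖a‖)) := by
    intro b hb
    refine le_trans ?_ hI
    rw [← lintegral_indicator Metric.isOpen_ball.measurableSet,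
      ← lintegral_indicator Metric.isOpen_ball.measurableSet,
      ← lintegral_add_right_eq_self ((Metric.ball (0 : RN N) (5 * ‖a‖)).indicator _) b]
    refine lintegral_mono fun z => ?_
    by_cases hz : z ∈ Metric.ball (0 : RN N) ρ
    · have : z + b ∈ Metric.ball (0 : RN N) (5 * ‖a‖) := by
        rw [mem_ball_zero_iff] at hz ⊢
        linarith [norm_add_le z b]
      simp [hz, this]
    · simp [hz]
  have hnear : ∫⁻ z in Metric.ball (0 : RN N) ρ, ‖f (z + a) + f (z - a) - 2 * f z‖ₑ ≤
      ENNReal.ofReal (20 * A * sphereArea N * ‖a‖) := by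
    calc _ ≤ ∫⁻ z in Metric.ball (0 : RN N) ρ,
          ((‖f (z + a)‖ₑ + ‖f (z + -a)‖ₑ) + (‖f (z + 0)‖ₑ + ‖f (z + 0)‖ₑ)) := by
          refine lintegral_mono fun z => ?_
          rw [add_zero, ← sub_eq_add_neg, two_mul]
          exact enorm_sub_le.trans (add_le_add (enorm_add_le _ _) (enorm_add_le _ _))
      _ = ((∫⁻ z in Metric.ball (0 : RN N) ρ, ‖f (z + a)‖ₑ) +
            (∫⁻ z in Metric.ball (0 : RN N) ρ, ‖f (z + -a)‖ₑ)) +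
          ((∫⁻ z in Metric.ball (0 : RN N) ρ, ‖f (z + 0)‖ₑ) +
            (∫⁻ z in Metric.ball (0 : RN N) ρ, ‖f (z + 0)‖ₑ)) := by
          rw [lintegral_add_left (by fun_prop), lintegral_add_left (by fun_prop),
            lintegral_add_left (by fun_prop)]
      _ ≤ (ENNReal.ofReal (A * sphereArea N * (5 * ‖a‖)) +
            ENNReal.ofReal (A * sphereArea N * (5 * ‖a‖))) +
          (ENNReal.ofReal (A * sphereArea N * (5 * ‖a‖)) +
            ENNReal.ofReal (A * sphereArea N * (5 * ‖a‖))) := by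
          have h0 := hshift 0 (by simp)
          have h1 := hshift a le_rfl
          have h3 := hshift (-a) (by simp)
          gcongr
      _ = _ := by
          rw [← ENNReal.ofReal_add (by positivity) (by positivity),
            ← ENNReal.ofReal_add (by positivity) (by positivity)]
          congr 1
          ring
  have hfar : ∫⁻ z in (Metric.ball (0 : RN N) ρ)ᶜ, ‖f (z + a) + f (z - a) - 2 * f z‖ₑ ≤
      ENNReal.ofReal (A * sphereArea N * ‖a‖) := by
    refine (lintegral_compl_ball_enorm_le hN (A := A * ‖a‖ ^ 2) (by positivity) hρ0
      (fun z hz => h2 z a ?_ ?_)).trans (ENNReal.ofReal_le_ofReal ?_)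
    · exact norm_pos_iff.1 (hρ0.trans_le hz)
    · linarith
    · rw [div_le_iff₀ hρ0, hρ]
      have : 0 ≤ A * ‖a‖ ^ 2 * sphereArea N := by positivity
      nlinarith
  rw [← lintegral_add_compl _ (Metric.isOpen_ball (x := (0 : RN N)) (ε := ρ)).measurableSet]
  refine (add_le_add hnear hfar).trans_eq ?_
  rw [← ENNReal.ofReal_add (by positivity) (by positivity)]
  congr 1
  ring

theorem HasKernelBounds.second (hK : HasKernelBounds A K) {z a : RN N} (hz : z ≠ 0)
    (ha : ‖a‖ ≤ ‖z‖ / 4) :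
    |K (z + a) + K (z - a) - 2 * K z| ≤ A * ‖a‖ ^ 2 / ‖z‖ ^ (N + 1) := by
  have := hK.mixed z a (-a) hz (by rw [norm_neg]; linarith)
  rw [norm_neg, add_neg_cancel_right, ← sub_eq_add_neg, ← abs_neg] at this
  convert! this using 2 <;> ring

theorem HasKernelBounds.nonneg (hN : 0 < N) (hK : HasKernelBounds A K) : 0 ≤ A := by
  have h := hK.size (EuclideanSpace.single ⟨0, hN⟩ 1) (by simp)
  simpa using (abs_nonneg _).trans h

/-! ### Truncation at infinity -/

/-- The cut-off `1 / (1 + |z|² / R²)`, which makes a kernel of size `|z|^{1-N}` integrable while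
leaving its scale-invariant bounds intact. -/
noncomputable def cutoff (R : ℝ) (z : RN N) : ℝ := (1 + ‖z‖ ^ 2 / R ^ 2)⁻¹

theorem cutoff_pos (R : ℝ) (z : RN N) : 0 < cutoff R z := by unfold cutoff; positivity

theorem cutoff_le_one (R : ℝ) (z : RN N) : cutoff R z ≤ 1 :=
  inv_le_one_of_one_le₀ (le_add_of_nonneg_right (by positivity))

theorem continuous_cutoff (R : ℝ) : Continuous (cutoff R : RN N → ℝ) := by
  unfold cutoff
  exact Continuous.inv₀ (by fun_prop) fun z => by positivity

theorem cutoff_le {R : ℝ} (hR : 0 < R) {z : RN N} (hz : z ≠ 0) :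
    cutoff R z ≤ R ^ 2 / ‖z‖ ^ 2 := by
  have hz0 : 0 < ‖z‖ := norm_pos_iff.2 hz
  rw [cutoff, ← inv_div (‖z‖ ^ 2) (R ^ 2)]
  exact inv_anti₀ (by positivity) (by linarith)

theorem abs_norm_add_sq_sub_le {z a : RN N} (ha : ‖a‖ ≤ ‖z‖) :
    |‖z + a‖ ^ 2 - ‖z‖ ^ 2| ≤ 3 * ‖a‖ * ‖z‖ := by
  have h1 := abs_norm_sub_norm_le (z + a) z
  rw [add_sub_cancel_left] at h1
  have h2 := norm_add_le z a
  have e : ‖z + a‖ ^ 2 - ‖z‖ ^ 2 = (‖z + a‖ - ‖z‖) * (‖z + a‖ + ‖z‖) := by ring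
  rw [e, abs_mul, abs_of_nonneg (by positivity : 0 ≤ ‖z + a‖ + ‖z‖)]
  calc _ ≤ ‖a‖ * (3 * ‖z‖) := by
        gcongr
        linarith
    _ = _ := by ring

theorem abs_cutoff_sub_le {R : ℝ} (hR : 0 < R) {z a : RN N} (hz : z ≠ 0) (ha : ‖a‖ ≤ ‖z‖) :
    |cutoff R (z + a) - cutoff R z| ≤ 3 * ‖a‖ / ‖z‖ := by
  have hz0 : 0 < ‖z‖ := norm_pos_iff.2 hz
  have e : cutoff R (z + a) - cutoff R z =
      -(cutoff R (z + a) * cutoff R z * ((‖z + a‖ ^ 2 - ‖z‖ ^ 2) / R ^ 2)) := by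
    unfold cutoff
    field_simp
    ring
  rw [e, abs_neg, abs_mul, abs_mul, abs_of_pos (cutoff_pos _ _), abs_of_pos (cutoff_pos _ _),
    abs_div, abs_of_pos (by positivity : 0 < R ^ 2)]
  calc _ ≤ 1 * (R ^ 2 / ‖z‖ ^ 2) * (3 * ‖a‖ * ‖z‖ / R ^ 2) := by
        gcongr
        · exact (cutoff_pos _ _).le
        · exact cutoff_le_one _ _
        · exact cutoff_le hR hz
        · exact abs_norm_add_sq_sub_le ha
    _ = _ := by
        field_simp

theorem abs_cutoff_second_difference_le {R : ℝ} (hR : 0 < R) {z a : RN N} (hz : z ≠ 0)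
    (ha : ‖a‖ ≤ ‖z‖) :
    |cutoff R (z + a) + cutoff R (z - a) - 2 * cutoff R z| ≤ 20 * ‖a‖ ^ 2 / ‖z‖ ^ 2 := by
  have hz0 : 0 < ‖z‖ := norm_pos_iff.2 hz
  have e : cutoff R (z + a) + cutoff R (z - a) - 2 * cutoff R z =
      -(cutoff R z * ((cutoff R (z + a) - cutoff R z) * ((‖z + a‖ ^ 2 - ‖z‖ ^ 2) / R ^ 2) +
        (cutoff R (z - a) - cutoff R z) * ((‖z - a‖ ^ 2 - ‖z‖ ^ 2) / R ^ 2) +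
        cutoff R z * ((‖z + a‖ ^ 2 + ‖z - a‖ ^ 2 - 2 * ‖z‖ ^ 2) / R ^ 2))) := by
    unfold cutoff
    field_simp
    ring
  have hpar : ‖z + a‖ ^ 2 + ‖z - a‖ ^ 2 - 2 * ‖z‖ ^ 2 = 2 * ‖a‖ ^ 2 := by
    have := parallelogram_law_with_norm ℝ z a
    nlinarith
  have h1 := abs_cutoff_sub_le hR hz ha
  have h2 := abs_cutoff_sub_le hR (a := -a) hz (by rwa [norm_neg])
  have h3 := abs_norm_add_sq_sub_le ha
  have h4 := abs_norm_add_sq_sub_le (a := -a) (z := z) (by rwa [norm_neg])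
  rw [norm_neg, ← sub_eq_add_neg] at h2 h4
  have hR2 : 0 < R ^ 2 := by positivity
  rw [e, hpar, abs_neg, abs_mul, abs_of_pos (cutoff_pos _ _)]
  calc _ ≤ R ^ 2 / ‖z‖ ^ 2 * (3 * ‖a‖ / ‖z‖ * (3 * ‖a‖ * ‖z‖ / R ^ 2) +
          3 * ‖a‖ / ‖z‖ * (3 * ‖a‖ * ‖z‖ / R ^ 2) + 1 * (2 * ‖a‖ ^ 2 / R ^ 2)) := by
        refine mul_le_mul (cutoff_le hR hz) ?_ (abs_nonneg _) (by positivity)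
        refine (abs_add_le _ _).trans (add_le_add ((abs_add_le _ _).trans (add_le_add ?_ ?_)) ?_)
        · rw [abs_mul, abs_div, abs_of_pos hR2]
          gcongr
        · rw [abs_mul, abs_div, abs_of_pos hR2]
          gcongr
        · rw [abs_mul, abs_of_pos (cutoff_pos _ _), abs_of_nonneg (by positivity)]
          gcongr
          exact cutoff_le_one _ _
    _ = _ := by
        field_simp
        ring

variable {R : ℝ}

theorem HasKernelBounds.abs_mul_cutoff_le (hK : HasKernelBounds A K) {z : RN N}
    (hz : z ≠ 0) : |K z * cutoff R z| ≤ A / ‖z‖ ^ (N - 1) := by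
  rw [abs_mul, abs_of_pos (cutoff_pos _ _)]
  exact (mul_le_of_le_one_right (abs_nonneg _) (cutoff_le_one _ _)).trans (hK.size z hz)

/-- The truncated kernels satisfy the second-difference bound uniformly in `R`. -/
theorem HasKernelBounds.mul_cutoff_second (hN : 0 < N) (hK : HasKernelBounds A K) (hR : 0 < R)
    {z a : RN N} (hz : z ≠ 0) (ha : ‖a‖ ≤ ‖z‖ / 4) :
    |K (z + a) * cutoff R (z + a) + K (z - a) * cutoff R (z - a) - 2 * (K z * cutoff R z)| ≤
      27 * A * ‖a‖ ^ 2 / ‖z‖ ^ (N + 1) := by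
  have hz0 : 0 < ‖z‖ := norm_pos_iff.2 hz
  have hA := hK.nonneg hN
  have ha1 : ‖a‖ ≤ ‖z‖ := by linarith
  have e : K (z + a) * cutoff R (z + a) + K (z - a) * cutoff R (z - a) -
      2 * (K z * cutoff R z) =
      (K (z + a) + K (z - a) - 2 * K z) * cutoff R z +
      K z * (cutoff R (z + a) + cutoff R (z - a) - 2 * cutoff R z) +
      (K (z + a) - K z) * (cutoff R (z + a) - cutoff R z) +
      (K (z - a) - K z) * (cutoff R (z - a) - cutoff R z) := by ring
  have h1 := hK.second hz ha
  have h2 := abs_cutoff_second_difference_le hR hz ha1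
  have h3 := abs_cutoff_sub_le hR hz ha1
  have h4 := abs_cutoff_sub_le hR (a := -a) hz (by rwa [norm_neg])
  have h5 := hK.first z a hz (by linarith)
  have h6 := hK.first z (-a) hz (by rw [norm_neg]; linarith)
  rw [norm_neg, ← sub_eq_add_neg] at h4 h6
  have h7 := hK.size z hz
  obtain ⟨n, rfl⟩ : ∃ n, N = n + 1 := ⟨N - 1, by omega⟩
  rw [Nat.add_sub_cancel] at h7
  rw [e]
  refine (abs_add_le _ _).trans ((add_le_add ((abs_add_le _ _).trans (add_le_add
    ((abs_add_le _ _).trans (add_le_add ?_ ?_)) ?_)) ?_).trans_eq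
    (?_ : A * ‖a‖ ^ 2 / ‖z‖ ^ (n + 2) * 1 + A / ‖z‖ ^ n * (20 * ‖a‖ ^ 2 / ‖z‖ ^ 2) +
      A * ‖a‖ / ‖z‖ ^ (n + 1) * (3 * ‖a‖ / ‖z‖) +
      A * ‖a‖ / ‖z‖ ^ (n + 1) * (3 * ‖a‖ / ‖z‖) = _))
  · rw [abs_mul, abs_of_pos (cutoff_pos _ _)]
    exact mul_le_mul h1 (cutoff_le_one _ _) (cutoff_pos _ _).le (by positivity)
  · rw [abs_mul]
    gcongr
  · rw [abs_mul]
    gcongr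
  · rw [abs_mul]
    gcongr
  · field_simp
    ring

theorem HasKernelBounds.integrable_mul_cutoff [Nontrivial (RN N)] (hN : 0 < N)
    (hK : HasKernelBounds A K) (hR : 0 < R) : Integrable (fun z => K z * cutoff R z) := by
  have hA := hK.nonneg hN
  refine ⟨(hK.measurable.mul (continuous_cutoff R).measurable).aestronglyMeasurable, ?_⟩
  rw [hasFiniteIntegral_iff_enorm,
    ← lintegral_add_compl _ (Metric.isOpen_ball (x := (0 : RN N)) (ε := R)).measurableSet]
  refine ENNReal.add_lt_top.2 ⟨?_, ?_⟩
  · exact (lintegral_ball_enorm_le hA (fun z hz => hK.abs_mul_cutoff_le hz) hR.le).trans_lt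
      ENNReal.ofReal_lt_top
  · refine (lintegral_compl_ball_enorm_le hN (A := A * R ^ 2) (by positivity) hR
      fun z hz => ?_).trans_lt ENNReal.ofReal_lt_top
    have hz0 : 0 < ‖z‖ := hR.trans_le hz
    have hz1 : z ≠ 0 := norm_pos_iff.1 hz0
    rw [abs_mul, abs_of_pos (cutoff_pos _ _)]
    have h1 := hK.size z hz1
    have h2 := cutoff_le hR hz1
    obtain ⟨n, rfl⟩ : ∃ n, N = n + 1 := ⟨N - 1, by omega⟩
    rw [Nat.add_sub_cancel] at h1
    calc _ ≤ A / ‖z‖ ^ n * (R ^ 2 / ‖z‖ ^ 2) :=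
          mul_le_mul h1 h2 (cutoff_pos _ _).le (by positivity)
      _ = _ := by
        field_simp
        ring

end Kernel

/-! ### Vitali selection -/

section Vitali

variable {N : ℕ}

/-- Vitali's covering lemma for balls of bounded radius, with a countable selection. -/
theorem exists_countable_vitali_selection {S : Set (RN N)} {r : RN N → ℝ} {R : ℝ}
    (hr : ∀ x ∈ S, 0 < r x) (hR : ∀ x ∈ S, r x ≤ R) :
    ∃ u ⊆ S, u.Countable ∧ u.PairwiseDisjoint (fun x => Metric.closedBall x (r x)) ∧
      S ⊆ ⋃ x ∈ u, Metric.closedBall x (5 * r x) := by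
  obtain ⟨u, huS, hu, hcov⟩ := Vitali.exists_disjoint_subfamily_covering_enlargement_closedBall
    S id r R hR 5 (by norm_num)
  refine ⟨u, huS, ?_, hu, fun x hx => ?_⟩
  · refine hu.countable_of_nonempty_interior fun x hx => ⟨x, ?_⟩
    exact Metric.ball_subset_interior_closedBall (Metric.mem_ball_self (hr x (huS hx)))
  · obtain ⟨b, hb, hxb⟩ := hcov x hx
    exact mem_biUnion hb (hxb (Metric.mem_closedBall_self (hr x hx).le))

theorem volume_closedBall_mul {c : ℝ} (hc : 0 ≤ c) (x y : RN N) {ρ : ℝ} (hρ : 0 ≤ ρ) :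
    volume (Metric.closedBall x (c * ρ)) =
      ENNReal.ofReal (c ^ N) * volume (Metric.closedBall y ρ) := by
  rw [Measure.addHaar_closedBall _ _ (by positivity), Measure.addHaar_closedBall _ _ hρ,
    ← mul_assoc, ← ENNReal.ofReal_mul (by positivity), finrank_euclideanSpace_fin, ← mul_pow]

/-- Balls of bounded volume have bounded radius. -/
theorem exists_radius_bound (hN : 0 < N) {M : ℝ≥0∞} (hM : M ≠ ∞) :
    ∃ R, ∀ (x : RN N) (r : ℝ), 0 < r → volume (Metric.closedBall x r) ≤ M → r ≤ R := by
  set ω : ℝ≥0∞ := volume (Metric.ball (0 : RN N) 1) with hω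
  have hω0 : ω ≠ 0 := (Metric.measure_ball_pos _ _ one_pos).ne'
  refine ⟨max 1 (M / ω).toReal, fun x r hr h1 => ?_⟩
  by_contra! hcon
  rw [max_lt_iff] at hcon
  rw [Measure.addHaar_closedBall _ _ hr.le, finrank_euclideanSpace_fin,
    ← ENNReal.le_div_iff_mul_le (Or.inl hω0) (Or.inl measure_ball_lt_top.ne)] at h1
  have h2 := (ENNReal.ofReal_le_iff_le_toReal (ENNReal.div_ne_top hM hω0)).1 h1
  have h3 : r ≤ r ^ N := le_self_pow₀ hcon.1.le hN.ne'
  linarith [hcon.2]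

/-- The covering argument behind the weak-type bound for maximal functions. -/
theorem mul_volume_le_of_closedBall (hN : 0 < N) {S : Set (RN N)} {r : RN N → ℝ} {κ : ℝ≥0∞}
    (hκ : κ ≠ 0) (hκ' : κ ≠ ∞) (l : Measure (RN N)) [IsFiniteMeasure l]
    (hr : ∀ x ∈ S, 0 < r x)
    (h : ∀ x ∈ S, κ * volume (Metric.closedBall x (r x)) ≤ l (Metric.closedBall x (r x))) :
    κ * volume S ≤ ENNReal.ofReal (5 ^ N) * l univ := by
  obtain ⟨R, hR⟩ := exists_radius_bound hN (M := l univ / κ)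
    (ENNReal.div_ne_top (measure_ne_top _ _) hκ)
  replace hR : ∀ x ∈ S, r x ≤ R := fun x hx => hR x _ (hr x hx) <| by
    rw [ENNReal.le_div_iff_mul_le (Or.inl hκ) (Or.inl hκ'), mul_comm]
    exact (h x hx).trans (measure_mono (subset_univ _))
  obtain ⟨u, huS, huc, hud, hcov⟩ := exists_countable_vitali_selection hr hR
  have := huc.to_subtype
  calc κ * volume S ≤ κ * ∑' x : u, volume (Metric.closedBall (x : RN N) (5 * r x)) := by
        gcongr
        refine (measure_mono hcov).trans ?_
        rw [biUnion_eq_iUnion]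
        exact measure_iUnion_le _
    _ = ENNReal.ofReal (5 ^ N) *
          ∑' x : u, κ * volume (Metric.closedBall (x : RN N) (r x)) := by
        rw [← ENNReal.tsum_mul_left, ← ENNReal.tsum_mul_left]
        refine tsum_congr fun x => ?_
        rw [volume_closedBall_mul (by norm_num) _ x.1 (hr x (huS x.2)).le, mul_left_comm]
    _ ≤ ENNReal.ofReal (5 ^ N) * ∑' x : u, l (Metric.closedBall (x : RN N) (r x)) := by
        gcongr with x
        exact h x (huS x.2)
    _ = ENNReal.ofReal (5 ^ N) * l (⋃ x : u, Metric.closedBall (x : RN N) (r x)) := by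
        rw [measure_iUnion (ι := u)
          (fun x y hxy => hud x.2 y.2 (Subtype.coe_injective.ne hxy))
          fun x => Metric.isClosed_closedBall.measurableSet]
    _ ≤ _ := by
        gcongr
        exact subset_univ _

end Vitali

/-! ### Functions with bounded second differences -/

section Zygmund

variable {N : ℕ} {u : RN N → ℝ} {T : ℝ}

theorem enorm_sq_eq_ofReal (t : ℝ) : ‖t‖ₑ ^ 2 = ENNReal.ofReal (t ^ 2) := by
  rw [Real.enorm_eq_ofReal_abs, ← ENNReal.ofReal_pow (abs_nonneg _), sq_abs]

/-- Symmetric second differences control mixed ones. -/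
theorem abs_mixed_difference_le (hZ : ∀ x a, |u (x + a) + u (x - a) - 2 * u x| ≤ T * ‖a‖)
    (hT : 0 ≤ T) (x a b : RN N) :
    |u (x + b + a) - u (x + b) - (u (x + a) - u x)| ≤ T * (‖a‖ + ‖b‖) := by
  have h1 := hZ (x + (2⁻¹ : ℝ) • (a + b)) ((2⁻¹ : ℝ) • (a + b))
  have h2 := hZ (x + (2⁻¹ : ℝ) • (a + b)) ((2⁻¹ : ℝ) • (a - b))
  have e1 : x + (2⁻¹ : ℝ) • (a + b) + (2⁻¹ : ℝ) • (a + b) = x + b + a := by module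
  have e2 : x + (2⁻¹ : ℝ) • (a + b) - (2⁻¹ : ℝ) • (a + b) = x := by module
  have e3 : x + (2⁻¹ : ℝ) • (a + b) + (2⁻¹ : ℝ) • (a - b) = x + a := by module
  have e4 : x + (2⁻¹ : ℝ) • (a + b) - (2⁻¹ : ℝ) • (a - b) = x + b := by module
  rw [e1, e2, norm_smul] at h1
  rw [e3, e4, norm_smul] at h2
  norm_num at h1 h2
  have h3 := mul_le_mul_of_nonneg_left (norm_add_le a b) hT
  have h4 := mul_le_mul_of_nonneg_left (norm_sub_le a b) hT
  rw [abs_le] at h1 h2 ⊢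
  constructor <;> linarith [h1.1, h1.2, h2.1, h2.2]

/-- A large difference `u y - u x` persists, up to reflecting the perturbation `b` of the step,
at all nearby base points `z`. -/
theorem le_sq_add_sq_of_large_difference
    (hZ : ∀ x a, |u (x + a) + u (x - a) - 2 * u x| ≤ T * ‖a‖) (hT : 0 ≤ T) {x a z b : RN N}
    (ha : 8 * T * ‖a‖ < |u (x + a) - u x|) (hz : ‖z - x‖ ≤ ‖a‖) (hb : ‖b‖ ≤ ‖a‖) :
    50 * (T * ‖a‖) ^ 2 ≤ (u (z + (a + b)) - u z) ^ 2 + (u (z + (a - b)) - u z) ^ 2 := by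
  have h1 := abs_mixed_difference_le hZ hT x a (z - x)
  have h2 := hZ (z + a) b
  rw [add_sub_cancel] at h1
  rw [add_assoc z a b, add_sub_assoc z a b] at h2
  have h3 : T * ‖z - x‖ ≤ T * ‖a‖ := by gcongr
  have h4 : T * ‖b‖ ≤ T * ‖a‖ := by gcongr
  have h0 : 0 ≤ T * ‖a‖ := by positivity
  set p := u (z + (a + b)) - u z with hp
  set q := u (z + (a - b)) - u z with hq
  have h5 : 11 * (T * ‖a‖) ≤ |p + q| := by
    rw [abs_le] at h1 h2
    rcases lt_abs.1 ha with h | h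
    · exact le_trans (by linarith [h1.1, h2.1]) (le_abs_self _)
    · exact le_trans (by linarith [h1.2, h2.2]) (neg_le_abs _)
  have h6 : (11 * (T * ‖a‖)) ^ 2 ≤ (p + q) ^ 2 := by
    rw [← sq_abs (p + q)]
    gcongr
  nlinarith [sq_nonneg (p - q), sq_nonneg (T * ‖a‖)]

/-- Averaging the previous lower bound over the perturbations of the step. -/
theorem le_lintegral_ball_of_large_difference (hu : Measurable u)
    (hZ : ∀ x a, |u (x + a) + u (x - a) - 2 * u x| ≤ T * ‖a‖) (hT : 0 ≤ T) {x a z : RN N}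
    (ha : 8 * T * ‖a‖ < |u (x + a) - u x|) (hz : ‖z - x‖ ≤ ‖a‖) :
    ENNReal.ofReal (25 * (T * ‖a‖) ^ 2) * volume (Metric.ball (0 : RN N) ‖a‖) ≤
      ∫⁻ w in Metric.ball (0 : RN N) (2 * ‖a‖), ‖u (z + w) - u z‖ₑ ^ 2 := by
  set B := Metric.ball (0 : RN N) ‖a‖ with hB
  have hBm : MeasurableSet B := Metric.isOpen_ball.measurableSet
  have hneg : ∫⁻ b in B, ‖u (z + (a - b)) - u z‖ₑ ^ 2 =
      ∫⁻ b in B, ‖u (z + (a + b)) - u z‖ₑ ^ 2 := by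
    rw [← lintegral_indicator hBm, ← lintegral_indicator hBm, ← lintegral_neg_eq_self]
    congr 1 with b
    simp only [indicator, hB, mem_ball_zero_iff, norm_neg, sub_neg_eq_add]
  have hsub : ∫⁻ b in B, ‖u (z + (a + b)) - u z‖ₑ ^ 2 ≤
      ∫⁻ w in Metric.ball (0 : RN N) (2 * ‖a‖), ‖u (z + w) - u z‖ₑ ^ 2 := by
    rw [← lintegral_indicator hBm, ← lintegral_indicator Metric.isOpen_ball.measurableSet,
      ← lintegral_add_left_eq_self ((Metric.ball (0 : RN N) (2 * ‖a‖)).indicator _) a]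
    refine lintegral_mono fun b => ?_
    by_cases hb : b ∈ B
    · have : a + b ∈ Metric.ball (0 : RN N) (2 * ‖a‖) := by
        rw [hB, mem_ball_zero_iff] at hb
        rw [mem_ball_zero_iff]
        linarith [norm_add_le a b]
      rw [indicator_of_mem hb, indicator_of_mem this]
    · rw [indicator_of_notMem hb]
      exact zero_le
  have hlow : ENNReal.ofReal (50 * (T * ‖a‖) ^ 2) * volume B ≤
      2 * ∫⁻ b in B, ‖u (z + (a + b)) - u z‖ₑ ^ 2 := by
    calc _ = ∫⁻ _ in B, ENNReal.ofReal (50 * (T * ‖a‖) ^ 2) := by rw [setLIntegral_const]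
      _ ≤ ∫⁻ b in B, (‖u (z + (a + b)) - u z‖ₑ ^ 2 + ‖u (z + (a - b)) - u z‖ₑ ^ 2) := by
          refine setLIntegral_mono' hBm fun b hb => ?_
          rw [enorm_sq_eq_ofReal, enorm_sq_eq_ofReal, ← ENNReal.ofReal_add (by positivity)
            (by positivity)]
          refine ENNReal.ofReal_le_ofReal
            (le_sq_add_sq_of_large_difference hZ hT ha hz ?_)
          exact (mem_ball_zero_iff.1 hb).le
      _ = _ := by
          rw [lintegral_add_left (by fun_prop), hneg, two_mul]
  have e : ENNReal.ofReal (50 * (T * ‖a‖) ^ 2) = 2 * ENNReal.ofReal (25 * (T * ‖a‖) ^ 2) := by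
    rw [show 50 * (T * ‖a‖) ^ 2 = 2 * (25 * (T * ‖a‖) ^ 2) by ring,
      ENNReal.ofReal_mul zero_le_two, ENNReal.ofReal_ofNat]
  rw [e, mul_assoc] at hlow
  exact ((ENNReal.mul_le_mul_iff_right two_ne_zero ENNReal.ofNat_ne_top).1 hlow).trans hsub

/-- A difference with step `n • h` telescopes into `n` differences with step `h`. -/
theorem lintegral_ball_telescope (hu : Measurable u) (n : ℕ) (x h : RN N) {r : ℝ}
    (hh : n * ‖h‖ ≤ 2 * r) :
    ∫⁻ z in Metric.ball x r, ‖u (z + n • h) - u z‖ₑ ^ 2 ≤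
      n ^ 2 * ∫⁻ z in Metric.closedBall x (3 * r), ‖u (z + h) - u z‖ₑ ^ 2 := by
  have hm : MeasurableSet (Metric.ball x r) := Metric.isOpen_ball.measurableSet
  have hpt : ∀ z, ‖u (z + n • h) - u z‖ₑ ^ 2 ≤
      n * ∑ k ∈ Finset.range n, ‖u (z + k • h + h) - u (z + k • h)‖ₑ ^ 2 := by
    intro z
    have e : u (z + n • h) - u z =
        ∑ k ∈ Finset.range n, (u (z + k • h + h) - u (z + k • h)) := by
      have := Finset.sum_range_sub (fun k => u (z + k • h)) n
      simp only [zero_smul, add_zero] at this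
      rw [← this]
      refine Finset.sum_congr rfl fun k _ => ?_
      rw [add_assoc, succ_nsmul]
    simp only [enorm_sq_eq_ofReal]
    rw [← ENNReal.ofReal_sum_of_nonneg fun _ _ => sq_nonneg _, ← ENNReal.ofReal_natCast,
      ← ENNReal.ofReal_mul (by positivity), e]
    refine ENNReal.ofReal_le_ofReal ?_
    simpa using sq_sum_le_card_mul_sum_sq (s := Finset.range n)
      (f := fun k => u (z + k • h + h) - u (z + k • h))
  calc _ ≤ ∫⁻ z in Metric.ball x r,
        n * ∑ k ∈ Finset.range n, ‖u (z + k • h + h) - u (z + k • h)‖ₑ ^ 2 :=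
        lintegral_mono hpt
    _ = n * ∑ k ∈ Finset.range n, ∫⁻ z in Metric.ball x r,
          ‖u (z + k • h + h) - u (z + k • h)‖ₑ ^ 2 := by
        rw [lintegral_const_mul _ (by fun_prop), lintegral_finsetSum _ (fun _ _ => by fun_prop)]
    _ ≤ n * ∑ k ∈ Finset.range n, ∫⁻ z in Metric.closedBall x (3 * r),
          ‖u (z + h) - u z‖ₑ ^ 2 := by
        refine mul_le_mul' le_rfl (Finset.sum_le_sum fun k hk => ?_)
        rw [← lintegral_indicator hm,
          ← lintegral_indicator Metric.isClosed_closedBall.measurableSet,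
          ← lintegral_add_right_eq_self ((Metric.closedBall x (3 * r)).indicator _) (k • h)]
        refine lintegral_mono fun z => ?_
        by_cases hz : z ∈ Metric.ball x r
        · have : z + k • h ∈ Metric.closedBall x (3 * r) := by
            rw [mem_ball_iff_norm] at hz
            rw [mem_closedBall_iff_norm, add_sub_right_comm]
            have h1 := norm_add_le (z - x) (k • h)
            have h2 : ‖k • h‖ ≤ n * ‖h‖ := by
              refine (norm_nsmul_le).trans ?_
              gcongr
              exact (Finset.mem_range.1 hk).le
            linarith
          rw [indicator_of_mem hz, indicator_of_mem this]
        · rw [indicator_of_notMem hz]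
          exact zero_le
    _ = _ := by
        rw [Finset.sum_const, Finset.card_range, nsmul_eq_mul, ← mul_assoc, sq]

/-- Scaling of an integral over a ball centred at the origin. -/
theorem lintegral_ball_comp_smul {Φ : RN N → ℝ≥0∞} (hΦ : Measurable Φ) {c : ℝ} (hc : 0 < c)
    (ρ : ℝ) :
    ∫⁻ w in Metric.ball (0 : RN N) ρ, Φ w =
      ENNReal.ofReal (c ^ N) * ∫⁻ h in Metric.ball (0 : RN N) (ρ / c), Φ (c • h) := by
  have hb : MeasurableSet (Metric.ball (0 : RN N) ρ) := Metric.isOpen_ball.measurableSet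
  have h1 := lintegral_map (μ := (volume : Measure (RN N))) (hΦ.indicator hb)
    (measurable_const_smul c)
  rw [Measure.map_addHaar_smul _ hc.ne', lintegral_smul_measure, lintegral_indicator hb] at h1
  have h2 : ∫⁻ h, (Metric.ball (0 : RN N) ρ).indicator Φ (c • h) =
      ∫⁻ h in Metric.ball (0 : RN N) (ρ / c), Φ (c • h) := by
    rw [← lintegral_indicator Metric.isOpen_ball.measurableSet]
    congr 1 with h
    have : c • h ∈ Metric.ball (0 : RN N) ρ ↔ h ∈ Metric.ball (0 : RN N) (ρ / c) := by
      rw [mem_ball_zero_iff, mem_ball_zero_iff, norm_smul, Real.norm_of_nonneg hc.le,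
        lt_div_iff₀ hc, mul_comm]
    by_cases hh : c • h ∈ Metric.ball (0 : RN N) ρ
    · rw [indicator_of_mem hh, indicator_of_mem (this.1 hh)]
    · rw [indicator_of_notMem hh, indicator_of_notMem (fun h' => hh (this.2 h'))]
  rw [← h2, ← h1, smul_eq_mul, ← mul_assoc, ← ENNReal.ofReal_mul (by positivity),
    finrank_euclideanSpace_fin, abs_of_pos (by positivity),
    mul_inv_cancel₀ (by positivity), ENNReal.ofReal_one, one_mul]

/-- The integral of the squared differences of `u` over the steps shorter than `2 ε`. -/
noncomputable def squareOscillation (u : RN N → ℝ) (ε : ℝ) (z : RN N) : ℝ≥0∞ :=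
  ∫⁻ h in Metric.ball (0 : RN N) (2 * ε), ‖u (z + h) - u z‖ₑ ^ 2

theorem measurable_difference_sq (hu : Measurable u) :
    Measurable (fun p : RN N × RN N => ‖u (p.1 + p.2) - u p.1‖ₑ ^ 2) := by
  fun_prop

/-- A large difference at scale `|a| ≥ ε` is felt by the square oscillation at the fixed scale `ε`
on a ball of radius comparable with `|a|`. -/
theorem mul_volume_le_lintegral_squareOscillation (hu : Measurable u)
    (hZ : ∀ x a, |u (x + a) + u (x - a) - 2 * u x| ≤ T * ‖a‖) (hT : 0 ≤ T) {ε : ℝ} (hε : 0 < ε)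
    {x a : RN N} (hεa : ε ≤ ‖a‖) (ha : 8 * T * ‖a‖ < |u (x + a) - u x|) :
    ENNReal.ofReal (T ^ 2 * (ε / 2) ^ (N + 2)) * volume (Metric.ball (0 : RN N) 1) *
        volume (Metric.ball (0 : RN N) ‖a‖) ≤
      ∫⁻ z in Metric.closedBall x (3 * ‖a‖), squareOscillation u ε z := by
  set r := ‖a‖ with hr
  have hr0 : 0 < r := hε.trans_le hεa
  set ω := volume (Metric.ball (0 : RN N) 1) with hω
  set V := volume (Metric.ball (0 : RN N) r) with hV
  set I := ∫⁻ z in Metric.closedBall x (3 * r), squareOscillation u ε z with hI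
  set Φ : RN N → ℝ≥0∞ := fun w => ∫⁻ z in Metric.ball x r, ‖u (z + w) - u z‖ₑ ^ 2 with hΦ
  have hΦm : Measurable Φ := Measurable.lintegral_prod_left'
    (μ := volume.restrict (Metric.ball x r)) (measurable_difference_sq hu)
  -- a step of length at most `2 r` is divided into `n` steps of length at most `2 ε`
  set n := ⌈r / ε⌉₊ with hn
  have hn1 : r / ε ≤ n := Nat.le_ceil _
  have hn2 : (n : ℝ) ≤ 2 * r / ε := by
    have h1 : (n : ℝ) < r / ε + 1 := Nat.ceil_lt_add_one (by positivity)
    have h2 : 1 ≤ r / ε := (one_le_div hε).2 hεa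
    have h3 : 2 * r / ε = 2 * (r / ε) := by ring
    linarith
  have hn0 : (0 : ℝ) < n := lt_of_lt_of_le (by positivity) hn1
  have h1 : ENNReal.ofReal (25 * (T * r) ^ 2) * V * V ≤
      ∫⁻ w in Metric.ball (0 : RN N) (2 * r), Φ w := by
    calc ENNReal.ofReal (25 * (T * r) ^ 2) * V * V
        = ∫⁻ _ in Metric.ball x r, ENNReal.ofReal (25 * (T * r) ^ 2) * V := by
          rw [setLIntegral_const, Measure.addHaar_ball_center]
      _ ≤ ∫⁻ z in Metric.ball x r, ∫⁻ w in Metric.ball (0 : RN N) (2 * r),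
            ‖u (z + w) - u z‖ₑ ^ 2 := by
          refine setLIntegral_mono' Metric.isOpen_ball.measurableSet fun z hz => ?_
          exact le_lintegral_ball_of_large_difference hu hZ hT ha (mem_ball_iff_norm.1 hz).le
      _ = _ := lintegral_lintegral_swap (measurable_difference_sq hu).aemeasurable
  have h2 : ∫⁻ w in Metric.ball (0 : RN N) (2 * r), Φ w ≤
      ENNReal.ofReal ((n : ℝ) ^ (N + 2)) * I := by
    rw [lintegral_ball_comp_smul hΦm hn0 (2 * r)]
    calc _ ≤ ENNReal.ofReal ((n : ℝ) ^ N) * ∫⁻ h in Metric.ball (0 : RN N) (2 * r / n),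
            n ^ 2 * ∫⁻ z in Metric.closedBall x (3 * r), ‖u (z + h) - u z‖ₑ ^ 2 := by
          refine mul_le_mul' le_rfl
            (setLIntegral_mono' Metric.isOpen_ball.measurableSet fun h hh => ?_)
          rw [hΦ, Nat.cast_smul_eq_nsmul]
          refine lintegral_ball_telescope hu n x h ?_
          rw [mem_ball_zero_iff, lt_div_iff₀ hn0] at hh
          linarith
      _ ≤ ENNReal.ofReal ((n : ℝ) ^ N) * ∫⁻ h in Metric.ball (0 : RN N) (2 * ε),
            n ^ 2 * ∫⁻ z in Metric.closedBall x (3 * r), ‖u (z + h) - u z‖ₑ ^ 2 := by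
          refine mul_le_mul' le_rfl (lintegral_mono_set (Metric.ball_subset_ball ?_))
          rw [div_le_iff₀ hn0]
          rw [div_le_iff₀ hε] at hn1
          linarith
      _ = _ := by
          rw [lintegral_const_mul _ (Measurable.lintegral_prod_left'
            (μ := volume.restrict (Metric.closedBall x (3 * r))) (measurable_difference_sq hu)),
            lintegral_lintegral_swap (f := fun h z => ‖u (z + h) - u z‖ₑ ^ 2)
              ((measurable_difference_sq hu).comp measurable_swap).aemeasurable, ← mul_assoc,
            pow_add, ENNReal.ofReal_mul (by positivity), ENNReal.ofReal_pow (by positivity) 2,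
            ENNReal.ofReal_natCast]
          rfl
  have h3 : ENNReal.ofReal (25 * (T * r) ^ 2) * V * V ≤
      ENNReal.ofReal ((2 * r / ε) ^ (N + 2)) * I := by
    refine (h1.trans h2).trans ?_
    gcongr
  have hVω : V = ENNReal.ofReal (r ^ N) * ω := by
    rw [hV, Measure.addHaar_ball_of_pos _ _ hr0, finrank_euclideanSpace_fin]
  calc ENNReal.ofReal (T ^ 2 * (ε / 2) ^ (N + 2)) * ω * V
      ≤ ENNReal.ofReal ((2 * r / ε)⁻¹ ^ (N + 2)) *
          (ENNReal.ofReal (25 * (T * r) ^ 2) * V * V) := by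
        nth_rw 2 [hVω]
        have e : ENNReal.ofReal ((2 * r / ε)⁻¹ ^ (N + 2)) *
            (ENNReal.ofReal (25 * (T * r) ^ 2) * (ENNReal.ofReal (r ^ N) * ω) * V) =
            ENNReal.ofReal ((2 * r / ε)⁻¹ ^ (N + 2) * (25 * (T * r) ^ 2) * r ^ N) * ω * V := by
          rw [ENNReal.ofReal_mul (q := r ^ N) (by positivity),
            ENNReal.ofReal_mul (q := 25 * (T * r) ^ 2) (by positivity)]
          ring
        rw [e]
        refine mul_le_mul' (mul_le_mul' (ENNReal.ofReal_le_ofReal ?_) le_rfl) le_rfl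
        have e2 : (2 * r / ε)⁻¹ ^ (N + 2) * (25 * (T * r) ^ 2) * r ^ N =
            25 * (T ^ 2 * (ε / 2) ^ (N + 2)) := by
          rw [inv_div, div_pow, div_pow, mul_pow 2 r]
          field_simp
          ring
        rw [e2]
        have : 0 ≤ T ^ 2 * (ε / 2) ^ (N + 2) := by positivity
        linarith
    _ ≤ ENNReal.ofReal ((2 * r / ε)⁻¹ ^ (N + 2)) *
          (ENNReal.ofReal ((2 * r / ε) ^ (N + 2)) * I) := by gcongr
    _ = I := by
        rw [← mul_assoc, ← ENNReal.ofReal_mul (by positivity), ← mul_pow,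
          inv_mul_cancel₀ (by positivity), one_pow, ENNReal.ofReal_one, one_mul]

/-- The dimensional constant in the Lusin–Lipschitz estimate for Zygmund functions. -/
noncomputable def zygmundConst (N : ℕ) : ℝ := 15 ^ N * 4 ^ (N + 2)

/-- The weak-type estimate restricted to differences at distance at least `ε`. The covering argument
is applied to the finite measure of density `squareOscillation u ε`; the final bound does not depend
on `ε`. -/
theorem volume_large_difference_at_scale_le (hN : 0 < N) (hu : Measurable u)
    (hZ : ∀ x a, |u (x + a) + u (x - a) - 2 * u x| ≤ T * ‖a‖) (hT : 0 < T) {D : ℝ≥0∞}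
    (hD : D ≠ ∞) (hL : ∀ h, ∫⁻ x, ‖u (x + h) - u x‖ₑ ^ 2 ≤ D * ENNReal.ofReal (‖h‖ ^ 2))
    {ε : ℝ} (hε : 0 < ε) :
    ENNReal.ofReal (T ^ 2) *
        volume {x | ∃ y, ε ≤ ‖y - x‖ ∧ 8 * T * ‖y - x‖ < |u y - u x|} ≤
      ENNReal.ofReal (zygmundConst N) * D := by
  set S := {x | ∃ y, ε ≤ ‖y - x‖ ∧ 8 * T * ‖y - x‖ < |u y - u x|} with hS
  set ω := volume (Metric.ball (0 : RN N) 1) with hω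
  have hω0 : ω ≠ 0 := (Metric.measure_ball_pos _ _ one_pos).ne'
  have hωt : ω ≠ ∞ := measure_ball_lt_top.ne
  set l : Measure (RN N) := volume.withDensity (squareOscillation u ε) with hl
  have hlu : l univ ≤ D * (ENNReal.ofReal ((2 * ε) ^ (N + 2)) * ω) := by
    rw [hl, withDensity_apply _ MeasurableSet.univ, Measure.restrict_univ]
    calc ∫⁻ z, squareOscillation u ε z
        = ∫⁻ h in Metric.ball (0 : RN N) (2 * ε), ∫⁻ z, ‖u (z + h) - u z‖ₑ ^ 2 :=
          lintegral_lintegral_swap (measurable_difference_sq hu).aemeasurable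
      _ ≤ ∫⁻ h in Metric.ball (0 : RN N) (2 * ε), D * ENNReal.ofReal ((2 * ε) ^ 2) := by
          refine setLIntegral_mono' Metric.isOpen_ball.measurableSet fun h hh => ?_
          refine (hL h).trans ?_
          gcongr
          exact (mem_ball_zero_iff.1 hh).le
      _ = _ := by
          rw [setLIntegral_const, Measure.addHaar_ball_of_pos _ _ (by positivity),
            finrank_euclideanSpace_fin, pow_add, ENNReal.ofReal_mul (by positivity)]
          ring
  have : IsFiniteMeasure l := ⟨hlu.trans_lt (ENNReal.mul_lt_top hD.lt_top
    (ENNReal.mul_lt_top ENNReal.ofReal_lt_top hωt.lt_top))⟩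
  have hy : ∀ x ∈ S, ∃ y, ε ≤ ‖y - x‖ ∧ 8 * T * ‖y - x‖ < |u y - u x| := fun x hx => hx
  choose! y hy1 hy2 using hy
  set c : ℝ := T ^ 2 * (ε / 2) ^ (N + 2) / 3 ^ N with hc
  have hc0 : 0 < c := by positivity
  have hvit := mul_volume_le_of_closedBall hN (S := S) (r := fun x => 3 * ‖y x - x‖)
    (κ := ENNReal.ofReal c * ω)
    (mul_ne_zero (by simpa using hc0) hω0)
    (ENNReal.mul_ne_top ENNReal.ofReal_ne_top hωt) l
    (fun x hx => mul_pos three_pos (hε.trans_le (hy1 x hx))) (fun x hx => by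
      have h1 := mul_volume_le_lintegral_squareOscillation hu hZ hT.le hε (hy1 x hx)
        (x := x) (by rw [add_sub_cancel]; exact hy2 x hx)
      rw [hl, withDensity_apply _ Metric.isClosed_closedBall.measurableSet]
      refine le_trans (le_of_eq ?_) h1
      have hyp : 0 ≤ ‖y x - x‖ := norm_nonneg _
      have : Nonempty (Fin N) := ⟨⟨0, hN⟩⟩
      rw [volume_closedBall_mul (by norm_num) _ 0 hyp, Measure.addHaar_closedBall_eq_addHaar_ball,
        show T ^ 2 * (ε / 2) ^ (N + 2) = c * 3 ^ N by rw [hc]; field_simp,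
        ENNReal.ofReal_mul hc0.le]
      ring)
  have h4 : ENNReal.ofReal c * ω * volume S ≤
      ENNReal.ofReal (5 ^ N) * (D * (ENNReal.ofReal ((2 * ε) ^ (N + 2)) * ω)) :=
    hvit.trans (by gcongr)
  have h5 : ω * (ENNReal.ofReal c * volume S) ≤
      ω * (ENNReal.ofReal (5 ^ N * (2 * ε) ^ (N + 2)) * D) := by
    rw [ENNReal.ofReal_mul (by positivity)]
    calc _ = ENNReal.ofReal c * ω * volume S := by ring
      _ ≤ _ := h4
      _ = _ := by ring
  have h6 := (ENNReal.mul_le_mul_iff_right hω0 hωt).1 h5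
  have e : T ^ 2 = 3 ^ N * (ε / 2)⁻¹ ^ (N + 2) * c := by
    rw [hc, inv_pow]
    field_simp
  have e2 : 3 ^ N * (ε / 2)⁻¹ ^ (N + 2) * (5 ^ N * (2 * ε) ^ (N + 2)) = zygmundConst N := by
    rw [zygmundConst, inv_div, div_pow, mul_pow, show (15 : ℝ) = 3 * 5 by norm_num, mul_pow,
      show (4 : ℝ) = 2 * 2 by norm_num, mul_pow]
    field_simp
  rw [e, ENNReal.ofReal_mul (q := c) (by positivity), mul_assoc, ← e2,
    ENNReal.ofReal_mul (q := 5 ^ N * (2 * ε) ^ (N + 2)) (by positivity), mul_assoc]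
  exact mul_le_mul' le_rfl h6

/-- A function whose second differences are bounded by `T |a|` and whose first differences have
`L²` norm at most `√D |h|` is `8 T`-Lipschitz off a set of measure `O(D / T²)`. -/
theorem volume_large_difference_le (hN : 0 < N) (hu : Measurable u)
    (hZ : ∀ x a, |u (x + a) + u (x - a) - 2 * u x| ≤ T * ‖a‖) (hT : 0 < T) {D : ℝ≥0∞}
    (hD : D ≠ ∞) (hL : ∀ h, ∫⁻ x, ‖u (x + h) - u x‖ₑ ^ 2 ≤ D * ENNReal.ofReal (‖h‖ ^ 2)) :
    ENNReal.ofReal (T ^ 2) * volume {x | ∃ y, 8 * T * ‖y - x‖ < |u y - u x|} ≤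
      ENNReal.ofReal (zygmundConst N) * D := by
  set S : ℕ → Set (RN N) := fun n =>
    {x | ∃ y, 1 / ((n : ℝ) + 1) ≤ ‖y - x‖ ∧ 8 * T * ‖y - x‖ < |u y - u x|} with hS
  have hmono : Monotone S := by
    intro m n hmn x ⟨y, h1, h2⟩
    exact ⟨y, (Nat.one_div_le_one_div hmn).trans h1, h2⟩
  have hU : {x | ∃ y, 8 * T * ‖y - x‖ < |u y - u x|} = ⋃ n, S n := by
    ext x
    simp only [mem_iUnion, hS, mem_ofPred_eq]
    constructor
    · rintro ⟨y, hy⟩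
      have hpos : 0 < ‖y - x‖ := by
        refine norm_pos_iff.2 fun h => ?_
        rw [sub_eq_zero.1 h] at hy
        simp at hy
      obtain ⟨n, hn⟩ := exists_nat_one_div_lt hpos
      exact ⟨n, y, hn.le, hy⟩
    · rintro ⟨n, y, -, hy⟩
      exact ⟨y, hy⟩
  rw [hU, hmono.measure_iUnion, ENNReal.mul_iSup]
  exact iSup_le fun n => volume_large_difference_at_scale_le hN hu hZ hT hD hL (by positivity)

end Zygmund

/-! ### Convolution operators with bounded Fourier multiplier on `L²` -/

section Multiplier

open FourierTransform Convolution

variable {N : ℕ}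

/-- Plancherel's identity when the function is continuous and both it and its Fourier transform are
integrable. -/
theorem integral_norm_sq_fourier_of_continuous {h : RN N → ℂ} (hc : Continuous h)
    (hi : Integrable h) (hi' : Integrable (𝓕 h)) :
    ∫ x, ‖h x‖ ^ 2 = ∫ ξ, ‖𝓕 h ξ‖ ^ 2 := by
  have h1 := VectorFourier.integral_sesq_fourierIntegral_eq_neg_flip (innerSL ℂ (E := ℂ))
    (L := innerₗ (RN N)) (f := h) (g := 𝓕 h) Real.continuous_fourierChar continuous_inner hi hi'
  have h2 : 𝓕⁻ (𝓕 h) = h := hc.fourierInv_fourier_eq hi hi'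
  have h3 : ∀ x, VectorFourier.fourierIntegral Real.fourierChar volume (-(innerₗ (RN N)).flip)
      (𝓕 h) x = h x := by
    intro x
    conv_rhs => rw [← h2]
    simp [VectorFourier.fourierIntegral, Real.fourierInv_eq, real_inner_comm]
  simp only [h3] at h1
  apply Complex.ofRealLI.injective
  rw [← LinearIsometry.integral_comp_comm, ← LinearIsometry.integral_comp_comm]
  have h4 : ∀ z : ℂ, innerSL ℂ z z = Complex.ofRealLI (‖z‖ ^ 2) := fun z => by
    simp [inner_self_eq_norm_sq_to_K]
  refine Eq.trans ?_ (h1.symm.trans ?_)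
  · exact integral_congr_ae (Eventually.of_forall fun x => (h4 (h x)).symm)
  · exact integral_congr_ae (Eventually.of_forall fun x => h4 (𝓕 h x))

theorem integrable_norm_sq_of_bounded {h : RN N → ℂ} (hi : Integrable h) {C : ℝ}
    (hC : ∀ x, ‖h x‖ ≤ C) : Integrable fun x => ‖h x‖ ^ 2 := by
  simp_rw [sq]
  exact hi.norm.mul_bdd (c := C) hi.norm.aestronglyMeasurable
    (Eventually.of_forall fun x => by simpa using hC x)

theorem lintegral_enorm_sq_eq {h : RN N → ℂ} (hi : Integrable fun x => ‖h x‖ ^ 2) :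
    ∫⁻ x, ‖h x‖ₑ ^ 2 = ENNReal.ofReal (∫ x, ‖h x‖ ^ 2) := by
  rw [ofReal_integral_eq_lintegral_ofReal hi (Eventually.of_forall fun x => sq_nonneg _)]
  refine lintegral_congr fun x => ?_
  rw [← ofReal_norm, ENNReal.ofReal_pow (norm_nonneg _)]

/-- The multiplier estimate on Schwartz functions, where Plancherel's identity applies directly. -/
theorem lintegral_convolution_schwartz_le {k : RN N → ℂ} (hk : Integrable k) {M : ℝ}
    (hM : ∀ ξ, ‖𝓕 k ξ‖ ≤ M) (φ : SchwartzMap (RN N) ℂ) :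
    ∫⁻ x, ‖∫ y, k y * φ (x - y)‖ₑ ^ 2 ≤ ENNReal.ofReal (M ^ 2) * ∫⁻ x, ‖φ x‖ₑ ^ 2 := by
  have hM0 : 0 ≤ M := (norm_nonneg _).trans (hM 0)
  set h : RN N → ℂ := k ⋆[ContinuousLinearMap.mul ℂ ℂ] φ with hh
  have hφb : BddAbove (range fun x => ‖φ x‖) :=
    ⟨SchwartzMap.seminorm ℝ 0 0 φ, by
      rintro _ ⟨x, rfl⟩
      exact SchwartzMap.norm_le_seminorm ℝ φ x⟩
  have hc : Continuous h :=
    hφb.continuous_convolution_right_of_integrable _ hk φ.continuous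
  have hi : Integrable h := hk.integrable_convolution _ φ.integrable
  have hF : 𝓕 h = fun ξ => 𝓕 k ξ * 𝓕 (φ : RN N → ℂ) ξ :=
    funext fun ξ => Real.fourier_mul_convolution_eq hk φ.integrable ξ
  have hFφ : Integrable (𝓕 (φ : RN N → ℂ)) := (𝓕 φ).integrable
  have hkm : AEStronglyMeasurable (𝓕 k) volume :=
    (VectorFourier.fourierIntegral_continuous Real.continuous_fourierChar continuous_inner
      hk).aestronglyMeasurable
  have hi' : Integrable (𝓕 h) := by
    rw [hF]
    exact hFφ.bdd_mul hkm (Eventually.of_forall hM)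
  have hinv : 𝓕⁻ (𝓕 h) = h := hc.fourierInv_fourier_eq hi hi'
  have hb : ∀ x, ‖h x‖ ≤ ∫ ξ, ‖𝓕 h ξ‖ := by
    intro x
    conv_lhs => rw [← hinv]
    rw [Real.fourierInv_eq]
    refine (norm_integral_le_integral_norm _).trans (le_of_eq ?_)
    simp_rw [Circle.norm_smul]
  have hφ2 : Integrable fun ξ => ‖𝓕 φ ξ‖ ^ 2 :=
    integrable_norm_sq_of_bounded (𝓕 φ).integrable fun x =>
      SchwartzMap.norm_le_seminorm ℝ (𝓕 φ) x
  have hφ3 : Integrable fun ξ => ‖φ ξ‖ ^ 2 :=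
    integrable_norm_sq_of_bounded φ.integrable fun x => SchwartzMap.norm_le_seminorm ℝ φ x
  calc ∫⁻ x, ‖∫ y, k y * φ (x - y)‖ₑ ^ 2 = ∫⁻ x, ‖h x‖ₑ ^ 2 := rfl
    _ = ENNReal.ofReal (∫ ξ, ‖𝓕 h ξ‖ ^ 2) := by
        rw [lintegral_enorm_sq_eq (integrable_norm_sq_of_bounded hi hb),
          integral_norm_sq_fourier_of_continuous hc hi hi']
    _ ≤ ENNReal.ofReal (∫ ξ, M ^ 2 * ‖𝓕 φ ξ‖ ^ 2) := by
        refine ENNReal.ofReal_le_ofReal (integral_mono_of_nonneg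
          (Eventually.of_forall fun _ => sq_nonneg _) (hφ2.const_mul _)
          (Eventually.of_forall fun ξ => ?_))
        simp only [hF, norm_mul, mul_pow]
        exact mul_le_mul_of_nonneg_right (pow_le_pow_left₀ (norm_nonneg _) (hM ξ) 2)
          (sq_nonneg _)
    _ = _ := by
        rw [integral_const_mul, SchwartzMap.integral_norm_sq_fourier,
          ENNReal.ofReal_mul (by positivity), lintegral_enorm_sq_eq hφ3]

theorem eLpNorm_two_sq {α E : Type*} [MeasurableSpace α] [NormedAddCommGroup E] (μ : Measure α)
    (f : α → E) : eLpNorm f 2 μ ^ 2 = ∫⁻ x, ‖f x‖ₑ ^ 2 ∂μ := by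
  have := eLpNorm_nnreal_pow_eq_lintegral (f := f) (μ := μ) (p := 2) two_ne_zero
  simpa using this

/-- Young's inequality `‖k * f‖₂ ≤ ‖k‖₁ ‖f‖₂`. -/
theorem lintegral_convolution_sq_le {k f : RN N → ℂ} (hk : Measurable k) (hf : Measurable f) :
    ∫⁻ x, ‖∫ y, k y * f (x - y)‖ₑ ^ 2 ≤ (∫⁻ y, ‖k y‖ₑ) ^ 2 * ∫⁻ x, ‖f x‖ₑ ^ 2 := by
  have hpt : ∀ x, ‖∫ y, k y * f (x - y)‖ₑ ^ 2 ≤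
      (∫⁻ y, ‖k y‖ₑ) * ∫⁻ y, ‖k y‖ₑ * ‖f (x - y)‖ₑ ^ 2 := by
    intro x
    have h1 : ‖∫ y, k y * f (x - y)‖ₑ ≤
        ∫⁻ y, (‖k y‖ₑ ^ (1 / 2 : ℝ)) * (‖k y‖ₑ ^ (1 / 2 : ℝ) * ‖f (x - y)‖ₑ) := by
      refine (enorm_integral_le_lintegral_enorm _).trans (lintegral_mono fun y => ?_)
      rw [enorm_mul, ← mul_assoc, ← ENNReal.rpow_add_of_nonneg _ _ (by norm_num) (by norm_num)]
      norm_num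
    have h2 := ENNReal.lintegral_mul_le_Lp_mul_Lq (volume : Measure (RN N))
      (p := 2) (q := 2) Real.HolderConjugate.two_two
      (f := fun y => ‖k y‖ₑ ^ (1 / 2 : ℝ)) (g := fun y => ‖k y‖ₑ ^ (1 / 2 : ℝ) * ‖f (x - y)‖ₑ)
      (by fun_prop) (by fun_prop)
    refine (pow_le_pow_left₀ zero_le (h1.trans h2) 2).trans_eq ?_
    rw [mul_pow, ← ENNReal.rpow_natCast, ← ENNReal.rpow_natCast, ← ENNReal.rpow_mul,
      ← ENNReal.rpow_mul]
    norm_num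
    congr 1
    · refine lintegral_congr fun y => ?_
      rw [← ENNReal.rpow_natCast, ← ENNReal.rpow_mul]
      norm_num
    · refine lintegral_congr fun y => ?_
      rw [mul_pow, ← ENNReal.rpow_natCast, ← ENNReal.rpow_mul]
      norm_num
  calc _ ≤ ∫⁻ x, (∫⁻ y, ‖k y‖ₑ) * ∫⁻ y, ‖k y‖ₑ * ‖f (x - y)‖ₑ ^ 2 := lintegral_mono hpt
    _ = (∫⁻ y, ‖k y‖ₑ) * ∫⁻ x, ∫⁻ y, ‖k y‖ₑ * ‖f (x - y)‖ₑ ^ 2 :=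
        lintegral_const_mul _ (Measurable.lintegral_prod_right' (ν := volume)
          (f := fun p : RN N × RN N => ‖k p.2‖ₑ * ‖f (p.1 - p.2)‖ₑ ^ 2) (by fun_prop))
    _ = (∫⁻ y, ‖k y‖ₑ) * ∫⁻ y, ∫⁻ x, ‖k y‖ₑ * ‖f (x - y)‖ₑ ^ 2 := by
        rw [lintegral_lintegral_swap]
        fun_prop
    _ = _ := by
        have : ∀ y, ∫⁻ x, ‖k y‖ₑ * ‖f (x - y)‖ₑ ^ 2 = ‖k y‖ₑ * ∫⁻ x, ‖f x‖ₑ ^ 2 := by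
          intro y
          rw [lintegral_const_mul' _ _ enorm_ne_top,
            lintegral_sub_right_eq_self (fun x => ‖f x‖ₑ ^ 2) y]
        simp_rw [this]
        rw [lintegral_mul_const _ hk.enorm, ← mul_assoc, sq]

theorem eLpNorm_two_le_of_lintegral_sq_le {α E E' : Type*} [MeasurableSpace α]
    [NormedAddCommGroup E] [NormedAddCommGroup E'] {μ : Measure α} {f : α → E} {g : α → E'}
    {C : ℝ≥0∞} (h : ∫⁻ x, ‖f x‖ₑ ^ 2 ∂μ ≤ C ^ 2 * ∫⁻ x, ‖g x‖ₑ ^ 2 ∂μ) :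
    eLpNorm f 2 μ ≤ C * eLpNorm g 2 μ := by
  rw [← eLpNorm_two_sq, ← eLpNorm_two_sq, ← mul_pow] at h
  exact (ENNReal.pow_le_pow_left_iff two_ne_zero).1 h

/-- Convolution with an integrable kernel is bounded on `L²` with norm at most the supremum of the
Fourier transform of the kernel. -/
theorem lintegral_convolution_le_of_fourier_le {k g : RN N → ℂ} (hk : Integrable k)
    (hkm : Measurable k) {M : ℝ} (hM : ∀ ξ, ‖𝓕 k ξ‖ ≤ M) (hgm : Measurable g) (hg : Integrable g)
    (hg2 : MemLp g 2) :
    ∫⁻ x, ‖∫ y, k y * g (x - y)‖ₑ ^ 2 ≤ ENNReal.ofReal (M ^ 2) * ∫⁻ x, ‖g x‖ₑ ^ 2 := by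
  have hM0 : 0 ≤ M := (norm_nonneg _).trans (hM 0)
  set k₁ : ℝ≥0∞ := ∫⁻ y, ‖k y‖ₑ with hk₁
  have hk₁' : k₁ ≠ ∞ := by
    have := hk.2
    rw [hasFiniteIntegral_iff_enorm] at this
    exact this.ne
  have key : ∀ δ : ℝ, 0 < δ → eLpNorm (fun x => ∫ y, k y * g (x - y)) 2 volume ≤
      ENNReal.ofReal M * (eLpNorm g 2 volume + ENNReal.ofReal δ) + k₁ * ENNReal.ofReal δ := by
    intro δ hδ
    obtain ⟨φ₀, hφc, hφs, hφ⟩ := MemLp.exist_eLpNorm_sub_le ENNReal.ofNat_ne_top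
      (by norm_num) hg2 hδ
    set φ : SchwartzMap (RN N) ℂ := hφc.toSchwartzMap hφs with hφdef
    have hφ' : eLpNorm (fun x => g x - φ x) 2 volume ≤ ENNReal.ofReal δ := hφ
    have h1 := eLpNorm_two_le_of_lintegral_sq_le (C := ENNReal.ofReal M)
      (f := fun x => ∫ y, k y * φ (x - y)) (g := φ) (μ := volume) (by
        rw [← ENNReal.ofReal_pow hM0]
        exact lintegral_convolution_schwartz_le hk hM φ)
    have h2 := eLpNorm_two_le_of_lintegral_sq_le (C := k₁)
      (f := fun x => ∫ y, k y * (g (x - y) - φ (x - y))) (g := fun x => g x - φ x) (μ := volume)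
      (lintegral_convolution_sq_le hkm (f := fun x => g x - φ x)
        (hgm.sub φ.continuous.measurable))
    have hφm : eLpNorm φ 2 volume ≤ eLpNorm g 2 volume + ENNReal.ofReal δ := by
      have e : (φ : RN N → ℂ) = fun x => g x - (g x - φ x) := by
        ext x
        ring
      rw [e]
      exact (eLpNorm_sub_le hgm.aestronglyMeasurable
        (hgm.sub φ.continuous.measurable).aestronglyMeasurable (by norm_num)).trans
        (add_le_add le_rfl hφ')
    have hsum : (fun x => ∫ y, k y * g (x - y)) =ᵐ[volume]
        (fun x => ∫ y, k y * φ (x - y)) + fun x => ∫ y, k y * (g (x - y) - φ (x - y)) := by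
      filter_upwards [hk.ae_convolution_exists (ContinuousLinearMap.mul ℂ ℂ) hg,
        hk.ae_convolution_exists (ContinuousLinearMap.mul ℂ ℂ) φ.integrable] with x h3 h4
      have h3' : Integrable fun y => k y * g (x - y) := h3
      have h4' : Integrable fun y => k y * φ (x - y) := h4
      simp only [Pi.add_apply, mul_sub]
      rw [integral_sub h3' h4']
      ring
    have hm : ∀ f : RN N → ℂ, Measurable f →
        AEStronglyMeasurable (fun x => ∫ y, k y * f (x - y)) volume := by
      intro f hf
      have : StronglyMeasurable (fun p : RN N × RN N => k p.2 * f (p.1 - p.2)) :=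
        (by fun_prop : Measurable _).stronglyMeasurable
      exact this.integral_prod_right.aestronglyMeasurable
    rw [eLpNorm_congr_ae hsum]
    refine (eLpNorm_add_le (hm φ φ.continuous.measurable)
      (hm (fun x => g x - φ x) (hgm.sub φ.continuous.measurable)) (by norm_num)).trans ?_
    refine add_le_add (h1.trans ?_) (h2.trans ?_)
    · gcongr
    · gcongr
  have hfin : eLpNorm (fun x => ∫ y, k y * g (x - y)) 2 volume ≤
      ENNReal.ofReal M * eLpNorm g 2 volume := by
    have hlim : Tendsto (fun n : ℕ => ENNReal.ofReal M *
        (eLpNorm g 2 volume + ENNReal.ofReal (1 / ((n : ℝ) + 1))) +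
        k₁ * ENNReal.ofReal (1 / ((n : ℝ) + 1))) atTop
        (𝓝 (ENNReal.ofReal M * (eLpNorm g 2 volume + 0) + k₁ * 0)) := by
      have h0 : Tendsto (fun n : ℕ => ENNReal.ofReal (1 / ((n : ℝ) + 1))) atTop (𝓝 0) := by
        simpa using ENNReal.tendsto_ofReal (tendsto_one_div_add_atTop_nhds_zero_nat (𝕜 := ℝ))
      refine Tendsto.add ?_ (ENNReal.Tendsto.const_mul h0 (Or.inr hk₁'))
      exact ENNReal.Tendsto.const_mul (tendsto_const_nhds.add h0) (Or.inr ENNReal.ofReal_ne_top)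
    rw [add_zero, mul_zero, add_zero] at hlim
    exact ge_of_tendsto' hlim fun n => key _ (by positivity)
  rw [← eLpNorm_two_sq, ← eLpNorm_two_sq, ENNReal.ofReal_pow hM0, ← mul_pow]
  gcongr

/-! ### The Fourier transform of a kernel with integrable second differences -/

theorem fourier_comp_add_right (f : RN N → ℂ) (a ξ : RN N) :
    𝓕 (fun z => f (z + a)) ξ = (Real.fourierChar (inner ℝ a ξ) : ℂ) * 𝓕 f ξ := by
  have := congrFun (VectorFourier.fourierIntegral_comp_add_right Real.fourierChar volume
    (innerₗ (RN N)) f a) ξ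
  exact this

/-- The second differences of `f` with the step `a` for which `e^{2π i ⟨a, ξ⟩} = -1` give
`4 |f̂(ξ)| ≤ C |a| = C / (2 |ξ|)`; the first differences gain back the factor `|ξ|`. -/
theorem norm_fourier_difference_le {f : RN N → ℂ} (hf : Integrable f) {C : ℝ} (hC : 0 ≤ C)
    (h2 : ∀ a, ∫⁻ z, ‖f (z + a) + f (z - a) - 2 * f z‖ₑ ≤ ENNReal.ofReal (C * ‖a‖)) (h ξ : RN N) :
    ‖𝓕 (fun z => f (z + h) - f z) ξ‖ ≤ C * ‖h‖ := by
  have hshift : ∀ a, Integrable (fun z => f (z + a)) := fun a => hf.comp_add_right a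
  have hsub : ∀ f g : RN N → ℂ, Integrable f → Integrable g →
      𝓕 (fun z => f z - g z) ξ = 𝓕 f ξ - 𝓕 g ξ := by
    intro f g hf hg
    simp only [Real.fourier_eq, smul_sub]
    exact integral_sub ((Real.fourierIntegral_convergent_iff ξ).2 hf)
      ((Real.fourierIntegral_convergent_iff ξ).2 hg)
  have e1 : 𝓕 (fun z => f (z + h) - f z) ξ =
      ((Real.fourierChar (inner ℝ h ξ) : ℂ) - 1) * 𝓕 f ξ := by
    rw [hsub _ _ (hshift h) hf, fourier_comp_add_right]
    ring
  have e2 : ‖(Real.fourierChar (inner ℝ h ξ) : ℂ) - 1‖ ≤ 2 * Real.pi * (‖h‖ * ‖ξ‖) := by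
    rw [Real.fourierChar_apply, mul_comm _ Complex.I]
    refine Real.norm_exp_I_mul_ofReal_sub_one_le.trans ?_
    rw [norm_mul, Real.norm_of_nonneg Real.two_pi_pos.le]
    gcongr
    exact norm_inner_le_norm h ξ
  rcases eq_or_ne ξ 0 with rfl | hξ
  · rw [e1]
    simp
    positivity
  have hξ0 : 0 < ‖ξ‖ := norm_pos_iff.2 hξ
  set a : RN N := (2 * ‖ξ‖ ^ 2)⁻¹ • ξ with ha
  have hna : ‖a‖ = (2 * ‖ξ‖)⁻¹ := by
    rw [ha, norm_smul, Real.norm_of_nonneg (by positivity)]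
    field_simp
  have hin : inner ℝ a ξ = 1 / 2 := by
    rw [ha, real_inner_smul_left, real_inner_self_eq_norm_sq]
    field_simp
  have c1 : (Real.fourierChar (1 / 2 : ℝ) : ℂ) = -1 := by
    rw [Real.fourierChar_apply]
    push_cast
    rw [← Complex.exp_pi_mul_I]
    congr 1
    ring
  have c2 : (Real.fourierChar (-(1 / 2) : ℝ) : ℂ) = -1 := by
    rw [AddChar.map_neg_eq_inv, Circle.coe_inv, c1]
    norm_num
  have e3 : 𝓕 (fun z => (f (z + a) - f z) - (f z - f (z + -a))) ξ = -4 * 𝓕 f ξ := by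
    rw [hsub (fun z => f (z + a) - f z) (fun z => f z - f (z + -a)) ((hshift a).sub hf)
        (hf.sub (hshift (-a))), hsub _ _ (hshift a) hf,
      hsub _ _ hf (hshift (-a)), fourier_comp_add_right, fourier_comp_add_right, inner_neg_left,
      hin, c1, c2]
    ring
  have e4 : ‖𝓕 (fun z => (f (z + a) - f z) - (f z - f (z + -a))) ξ‖ ≤ C * ‖a‖ := by
    rw [← ENNReal.ofReal_le_ofReal_iff (by positivity), ofReal_norm, Real.fourier_eq]
    refine (enorm_integral_le_lintegral_enorm _).trans (le_trans (le_of_eq ?_) (h2 a))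
    refine lintegral_congr fun z => ?_
    rw [← ofReal_norm, Circle.norm_smul, ofReal_norm, ← sub_eq_add_neg]
    congr 1
    ring
  have e5 : ‖𝓕 f ξ‖ ≤ C * (2 * ‖ξ‖)⁻¹ / 4 := by
    rw [e3, norm_mul, hna] at e4
    norm_num at e4
    norm_num
    linarith
  rw [e1, norm_mul]
  calc _ ≤ 2 * Real.pi * (‖h‖ * ‖ξ‖) * (C * (2 * ‖ξ‖)⁻¹ / 4) := by gcongr
    _ = Real.pi / 4 * (C * ‖h‖) := by
        field_simp
    _ ≤ 1 * (C * ‖h‖) := by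
        gcongr
        linarith [Real.pi_le_four]
    _ = _ := one_mul _

end Multiplier

/-! ### Potentials of measures with bounded density -/

section BoundedDensity

open FourierTransform

variable {N : ℕ} {A M : ℝ} {K : RN N → ℝ} {m : Measure (RN N)}

theorem lintegral_le_of_le_smul (hm : m ≤ ENNReal.ofReal M • volume) (f : RN N → ℝ≥0∞) :
    ∫⁻ y, f y ∂m ≤ ENNReal.ofReal M * ∫⁻ y, f y := by
  rw [← smul_eq_mul, ← lintegral_smul_measure]
  exact lintegral_mono' hm le_rfl

/-- The kernel is bounded off the unit ball. -/
theorem HasKernelBounds.enorm_le_indicator_ball_add (hN : 0 < N) (hK : HasKernelBounds A K)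
    (z : RN N) : ‖K z‖ₑ ≤
      (Metric.ball (0 : RN N) 1).indicator (fun z => ‖K z‖ₑ) z + ENNReal.ofReal A := by
  by_cases hz : z ∈ Metric.ball (0 : RN N) 1
  · rw [indicator_of_mem hz]
    exact le_self_add
  · rw [indicator_of_notMem hz, zero_add, Real.enorm_eq_ofReal_abs]
    have h1 : 1 ≤ ‖z‖ := by simpa using hz
    refine ENNReal.ofReal_le_ofReal ((hK.size _ (norm_pos_iff.1 (by linarith))).trans ?_)
    exact div_le_self (hK.nonneg hN) (one_le_pow₀ h1)

theorem HasKernelBounds.integrable_of_le_smul [Nontrivial (RN N)] (hN : 0 < N)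
    (hK : HasKernelBounds A K) [IsFiniteMeasure m] (hm : m ≤ ENNReal.ofReal M • volume) (x : RN N) :
    Integrable (fun y => K (x - y)) m := by
  have hA := hK.nonneg hN
  have hKm := hK.measurable
  refine ⟨(hKm.comp (measurable_const_sub x)).aestronglyMeasurable, ?_⟩
  rw [hasFiniteIntegral_iff_enorm]
  set B := Metric.ball (0 : RN N) 1 with hB
  have hBm : MeasurableSet B := Metric.isOpen_ball.measurableSet
  calc _ ≤ ∫⁻ y, (B.indicator (fun z => ‖K z‖ₑ) (x - y) + ENNReal.ofReal A) ∂m :=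
        lintegral_mono fun y => hK.enorm_le_indicator_ball_add hN (x - y)
    _ = (∫⁻ y, B.indicator (fun z => ‖K z‖ₑ) (x - y) ∂m) + ENNReal.ofReal A * m univ := by
        rw [lintegral_add_right _ measurable_const, lintegral_const]
    _ ≤ ENNReal.ofReal M * (∫⁻ y, B.indicator (fun z => ‖K z‖ₑ) (x - y)) +
          ENNReal.ofReal A * m univ := by
        gcongr
        exact lintegral_le_of_le_smul hm _
    _ = ENNReal.ofReal M * (∫⁻ z in B, ‖K z‖ₑ) + ENNReal.ofReal A * m univ := by
        rw [lintegral_sub_left_eq_self (B.indicator fun z => ‖K z‖ₑ) x, lintegral_indicator hBm]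
    _ < ∞ := by
        refine ENNReal.add_lt_top.2 ⟨ENNReal.mul_lt_top ENNReal.ofReal_lt_top
          ((lintegral_ball_enorm_le hA hK.size zero_le_one).trans_lt ENNReal.ofReal_lt_top),
          ENNReal.mul_lt_top ENNReal.ofReal_lt_top (measure_lt_top _ _)⟩

/-- A density of a bounded multiple of Lebesgue measure, chosen bounded everywhere. -/
theorem exists_bounded_density [IsFiniteMeasure m] (hM : 0 ≤ M)
    (hm : m ≤ ENNReal.ofReal M • volume) :
    ∃ g : RN N → ℝ, Measurable g ∧ (∀ y, 0 ≤ g y) ∧ (∀ y, g y ≤ M) ∧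
      m = volume.withDensity fun y => ENNReal.ofReal (g y) := by
  have hac : m ≪ volume := Measure.absolutelyContinuous_of_le_smul hm
  set ρ := m.rnDeriv volume with hρ
  have hρm : Measurable ρ := Measure.measurable_rnDeriv _ _
  have hρM : ∀ᵐ y, ρ y ≤ ENNReal.ofReal M := by
    refine ae_le_of_forall_setLIntegral_le_of_sigmaFinite hρm fun s hs _ => ?_
    rw [Measure.setLIntegral_rnDeriv hac, setLIntegral_const]
    exact hm s
  refine ⟨fun y => (min (ρ y) (ENNReal.ofReal M)).toReal, by fun_prop, fun y =>
    ENNReal.toReal_nonneg, fun y => ?_, ?_⟩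
  · exact ENNReal.toReal_le_of_le_ofReal hM (min_le_right _ _)
  · conv_lhs => rw [← Measure.withDensity_rnDeriv_eq m volume hac]
    refine withDensity_congr_ae ?_
    filter_upwards [hρM] with y hy
    rw [ENNReal.ofReal_toReal (ne_top_of_le_ne_top ENNReal.ofReal_ne_top (min_le_right _ _)),
      min_eq_left hy]

/-- The dimensional multiple of the kernel constant bounding differences of potentials. -/
noncomputable def differenceConst (N : ℕ) (A : ℝ) : ℝ := 21 * (27 * A) * sphereArea N

theorem HasKernelBounds.differenceConst_nonneg (hN : 0 < N) (hK : HasKernelBounds A K) :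
    0 ≤ differenceConst N A := by
  have := hK.nonneg hN
  have := sphereArea_nonneg N
  unfold differenceConst
  positivity

theorem HasKernelBounds.abs_potential_second_difference_le [Nontrivial (RN N)] (hN : 0 < N)
    (hK : HasKernelBounds A K) [IsFiniteMeasure m] (hM : 0 ≤ M)
    (hm : m ≤ ENNReal.ofReal M • volume) (x a : RN N) :
    |(∫ y, K (x + a - y) ∂m) + (∫ y, K (x - a - y) ∂m) - 2 * ∫ y, K (x - y) ∂m| ≤
      differenceConst N A * M * ‖a‖ := by
  have hA := hK.nonneg hN
  have hC := hK.differenceConst_nonneg hN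
  have hi := hK.integrable_of_le_smul hN hm
  rw [← integral_add (hi _) (hi _), ← integral_const_mul,
    ← integral_sub (by exact (hi _).add (hi _)) ((hi _).const_mul _), ← Real.norm_eq_abs,
    ← ENNReal.ofReal_le_ofReal_iff (by positivity), ofReal_norm]
  refine (enorm_integral_le_lintegral_enorm _).trans ((lintegral_le_of_le_smul hm _).trans ?_)
  have e : ∫⁻ y, ‖K (x + a - y) + K (x - a - y) - 2 * K (x - y)‖ₑ =
      ∫⁻ z, ‖K (z + a) + K (z - a) - 2 * K z‖ₑ := by
    rw [← lintegral_sub_left_eq_self (fun z => ‖K (z + a) + K (z - a) - 2 * K z‖ₑ) x]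
    refine lintegral_congr fun y => ?_
    rw [add_sub_right_comm x a y, sub_right_comm x a y]
  rw [e, mul_comm (differenceConst N A) M, mul_assoc, ENNReal.ofReal_mul hM]
  gcongr
  refine (lintegral_second_difference_le hN hA hK.measurable hK.size
    (fun z a hz ha => hK.second hz ha) a).trans (ENNReal.ofReal_le_ofReal ?_)
  unfold differenceConst
  have := sphereArea_nonneg N
  gcongr
  linarith

/-- The truncated kernels are integrable and have uniformly controlled second differences, so the
multiplier theorem applies to their first differences. -/
theorem HasKernelBounds.lintegral_truncated_potential_difference_le [Nontrivial (RN N)]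
    (hN : 0 < N) (hK : HasKernelBounds A K) {g : RN N → ℝ} (hgm : Measurable g)
    (hg0 : ∀ y, 0 ≤ g y) (hgM : ∀ y, g y ≤ M) (hg : Integrable g) {R : ℝ} (hR : 0 < R) (h : RN N) :
    ∫⁻ x, ‖∫ y, (K (x + h - y) * cutoff R (x + h - y) - K (x - y) * cutoff R (x - y)) * g y‖ₑ ^ 2 ≤
      ENNReal.ofReal ((differenceConst N A * ‖h‖) ^ 2) * ∫⁻ x, ‖g x‖ₑ ^ 2 := by
  have hA := hK.nonneg hN
  have hC := hK.differenceConst_nonneg hN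
  have hKm := hK.measurable
  have hcm : Measurable (cutoff R : RN N → ℝ) := (continuous_cutoff R).measurable
  set f : RN N → ℝ := fun z => K z * cutoff R z with hf
  have hfm : Measurable f := by fun_prop
  have hfi : Integrable f := hK.integrable_mul_cutoff hN hR
  have hF := norm_fourier_difference_le (f := fun z => (f z : ℂ)) hfi.ofReal hC (fun a => by
    refine le_trans (le_of_eq ?_) (lintegral_second_difference_le hN (A := 27 * A) (by positivity)
      hfm (fun z hz => (hK.abs_mul_cutoff_le hz).trans (by gcongr; linarith))
      (fun z a hz ha => hK.mul_cutoff_second hN hR hz ha) a)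
    refine lintegral_congr fun z => ?_
    rw [← ofReal_norm, ← ofReal_norm, ← Complex.norm_real]
    push_cast
    rfl) h
  have hgi : Integrable (fun y => (g y : ℂ)) := hg.ofReal
  have hg2 : MemLp (fun y => (g y : ℂ)) 2 := by
    refine (memLp_two_iff_integrable_sq_norm hgi.aestronglyMeasurable).2
      (integrable_norm_sq_of_bounded hgi (C := M) fun y => ?_)
    rw [Complex.norm_real, Real.norm_of_nonneg (hg0 y)]
    exact hgM y
  have hmain := lintegral_convolution_le_of_fourier_le
    (k := fun z => (f (z + h) : ℂ) - (f z : ℂ)) (g := fun y => (g y : ℂ))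
    ((hfi.comp_add_right h).ofReal.sub hfi.ofReal) (by fun_prop) hF (by fun_prop) hgi hg2
  refine le_trans (le_of_eq ?_) (hmain.trans (le_of_eq ?_))
  · refine lintegral_congr fun x => ?_
    congr 1
    rw [← integral_sub_left_eq_self
      (fun y => ((f (y + h) : ℂ) - (f y : ℂ)) * (g (x - y) : ℂ)) volume x]
    rw [← ofReal_norm, ← ofReal_norm, ← Complex.norm_real, ← integral_complex_ofReal]
    congr 2
    refine integral_congr_ae (Eventually.of_forall fun y => ?_)
    simp only [hf, sub_sub_cancel]
    rw [sub_add_eq_add_sub]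
    push_cast
    rfl
  · congr 1
    refine lintegral_congr fun x => ?_
    rw [← ofReal_norm, ← ofReal_norm, Complex.norm_real]

theorem tendsto_cutoff (z : RN N) :
    Tendsto (fun n : ℕ => cutoff ((n : ℝ) + 1) z) atTop (𝓝 1) := by
  have h1 : Tendsto (fun n : ℕ => ‖z‖ ^ 2 / ((n : ℝ) + 1) ^ 2) atTop (𝓝 0) := by
    refine Tendsto.div_atTop tendsto_const_nhds ?_
    exact (tendsto_pow_atTop two_ne_zero).comp
      (tendsto_atTop_add_const_right _ _ tendsto_natCast_atTop_atTop)
  have h2 : Tendsto (fun n : ℕ => (1 + ‖z‖ ^ 2 / ((n : ℝ) + 1) ^ 2)⁻¹) atTop (𝓝 (1 + 0)⁻¹) :=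
    (tendsto_const_nhds.add h1).inv₀ (by norm_num)
  simpa [cutoff] using h2

/-- The `L²` estimate for the truncated kernels passes to the limit by Fatou's lemma. -/
theorem HasKernelBounds.lintegral_potential_difference_le [Nontrivial (RN N)] (hN : 0 < N)
    (hK : HasKernelBounds A K) [IsFiniteMeasure m] (hM : 0 ≤ M)
    (hm : m ≤ ENNReal.ofReal M • volume) (h : RN N) :
    ∫⁻ x, ‖(∫ y, K (x + h - y) ∂m) - ∫ y, K (x - y) ∂m‖ₑ ^ 2 ≤
      ENNReal.ofReal (differenceConst N A ^ 2 * M) * m univ * ENNReal.ofReal (‖h‖ ^ 2) := by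
  have hKm := hK.measurable
  have hC := hK.differenceConst_nonneg hN
  obtain ⟨g, hgm, hg0, hgM, hmg⟩ := exists_bounded_density hM hm
  have hmu : m univ = ∫⁻ y, ENNReal.ofReal (g y) := by
    rw [hmg, withDensity_apply _ MeasurableSet.univ, Measure.restrict_univ]
  have hgi : Integrable g := by
    refine ⟨hgm.aestronglyMeasurable, ?_⟩
    rw [hasFiniteIntegral_iff_ofReal (Eventually.of_forall hg0), ← hmu]
    exact measure_lt_top _ _
  have hg2 : ∫⁻ x, ‖g x‖ₑ ^ 2 ≤ ENNReal.ofReal M * m univ := by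
    rw [hmu, ← lintegral_const_mul _ (by fun_prop)]
    refine lintegral_mono fun y => ?_
    rw [enorm_sq_eq_ofReal, ← ENNReal.ofReal_mul hM, sq]
    exact ENNReal.ofReal_le_ofReal (mul_le_mul_of_nonneg_right (hgM y) (hg0 y))
  have hint : ∀ F : RN N → ℝ, ∫ y, F y ∂m = ∫ y, F y * g y := by
    intro F
    rw [hmg, integral_withDensity_eq_integral_toReal_smul (by fun_prop)
      (Eventually.of_forall fun y => ENNReal.ofReal_lt_top)]
    refine integral_congr_ae (Eventually.of_forall fun y => ?_)
    simp only [smul_eq_mul]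
    rw [ENNReal.toReal_ofReal (hg0 y), mul_comm]
  set w : ℕ → RN N → ℝ := fun n x => ∫ y, (K (x + h - y) * cutoff ((n : ℝ) + 1) (x + h - y) -
    K (x - y) * cutoff ((n : ℝ) + 1) (x - y)) ∂m with hw
  have hcm : ∀ R : ℝ, Measurable (cutoff R : RN N → ℝ) := fun R =>
    (continuous_cutoff R).measurable
  have hwm : ∀ n, Measurable (w n) := fun n => by
    have hc := hcm ((n : ℝ) + 1)
    have : StronglyMeasurable (fun p : RN N × RN N =>
        K (p.1 + h - p.2) * cutoff ((n : ℝ) + 1) (p.1 + h - p.2) -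
          K (p.1 - p.2) * cutoff ((n : ℝ) + 1) (p.1 - p.2)) :=
      (by fun_prop : Measurable _).stronglyMeasurable
    exact this.integral_prod_right.measurable
  have hlim : ∀ x, Tendsto (fun n => w n x) atTop
      (𝓝 ((∫ y, K (x + h - y) ∂m) - ∫ y, K (x - y) ∂m)) := by
    intro x
    have hi1 := hK.integrable_of_le_smul hN hm (x + h)
    have hi2 := hK.integrable_of_le_smul hN hm x
    rw [← integral_sub hi1 hi2]
    refine tendsto_integral_of_dominated_convergence
      (fun y => ‖K (x + h - y)‖ + ‖K (x - y)‖) (fun n => ?_) (hi1.norm.add hi2.norm)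
      (fun n => Eventually.of_forall fun y => ?_) (Eventually.of_forall fun y => ?_)
    · have hc := hcm ((n : ℝ) + 1)
      exact (by fun_prop : Measurable _).aestronglyMeasurable
    · refine (norm_sub_le _ _).trans (add_le_add ?_ ?_) <;>
      · rw [norm_mul, Real.norm_of_nonneg (cutoff_pos _ _).le]
        exact mul_le_of_le_one_right (norm_nonneg _) (cutoff_le_one _ _)
    · have := ((tendsto_cutoff (x + h - y)).const_mul (K (x + h - y))).sub
        ((tendsto_cutoff (x - y)).const_mul (K (x - y)))
      simpa using this
  have hbound : ∀ n, ∫⁻ x, ‖w n x‖ₑ ^ 2 ≤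
      ENNReal.ofReal (differenceConst N A ^ 2 * M) * m univ * ENNReal.ofReal (‖h‖ ^ 2) := by
    intro n
    have h1 := hK.lintegral_truncated_potential_difference_le hN hgm hg0 hgM hgi
      (R := (n : ℝ) + 1) (by positivity) h
    simp only [hw, hint]
    refine h1.trans ((mul_le_mul' le_rfl hg2).trans (le_of_eq ?_))
    rw [mul_pow, ENNReal.ofReal_mul (by positivity), ENNReal.ofReal_mul (by positivity)]
    ring
  calc _ = ∫⁻ x, liminf (fun n => ‖w n x‖ₑ ^ 2) atTop := by
        refine lintegral_congr fun x => ?_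
        exact ((((ENNReal.continuous_pow 2).comp continuous_enorm).tendsto _).comp
          (hlim x)).liminf_eq.symm
    _ ≤ liminf (fun n => ∫⁻ x, ‖w n x‖ₑ ^ 2) atTop :=
        lintegral_liminf_le fun n => (hwm n).enorm.pow_const 2
    _ ≤ _ := by
        refine (liminf_le_liminf (Eventually.of_forall hbound)).trans ?_
        simp

/-- The potential of a measure with density at most `M` is `O(M)`-Lipschitz off a set of measure
`O(m(ℝᴺ) / M)`. -/
theorem HasKernelBounds.volume_potential_large_difference_le [Nontrivial (RN N)] (hN : 0 < N)
    (hK : HasKernelBounds A K) [IsFiniteMeasure m] (hM : 0 < M)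
    (hm : m ≤ ENNReal.ofReal M • volume) :
    volume {x | ∃ y, 8 * ((differenceConst N A + 1) * M) * ‖y - x‖ <
        |(∫ z, K (y - z) ∂m) - ∫ z, K (x - z) ∂m|} ≤
      ENNReal.ofReal (zygmundConst N / M) * m univ := by
  have hKm := hK.measurable
  have hC := hK.differenceConst_nonneg hN
  set C := differenceConst N A with hCdef
  have hum : Measurable (fun x => ∫ z, K (x - z) ∂m) := by
    have : StronglyMeasurable (fun p : RN N × RN N => K (p.1 - p.2)) :=
      (by fun_prop : Measurable _).stronglyMeasurable
    exact this.integral_prod_right.measurable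
  have h1 := volume_large_difference_le hN hum (T := (C + 1) * M)
    (D := ENNReal.ofReal (C ^ 2 * M) * m univ) (fun x a =>
      (hK.abs_potential_second_difference_le hN hM.le hm x a).trans (by gcongr; linarith))
    (by positivity) (ENNReal.mul_ne_top ENNReal.ofReal_ne_top (measure_ne_top _ _))
    (hK.lintegral_potential_difference_le hN hM.le hm)
  set S := {x | ∃ y, 8 * ((C + 1) * M) * ‖y - x‖ <
        |(∫ z, K (y - z) ∂m) - ∫ z, K (x - z) ∂m|} with hS
  have hT0 : ENNReal.ofReal (((C + 1) * M) ^ 2) ≠ 0 := by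
    rw [ne_eq, ENNReal.ofReal_eq_zero, not_le]
    positivity
  refine (ENNReal.mul_le_mul_iff_right hT0 ENNReal.ofReal_ne_top).1 (h1.trans ?_)
  have hz : 0 ≤ zygmundConst N := by unfold zygmundConst; positivity
  rw [← mul_assoc, ← mul_assoc, ← ENNReal.ofReal_mul (by positivity),
    ← ENNReal.ofReal_mul (by positivity)]
  refine mul_le_mul' (ENNReal.ofReal_le_ofReal ?_) le_rfl
  rw [mul_pow]
  have e : (C + 1) ^ 2 * M ^ 2 * (zygmundConst N / M) = zygmundConst N * ((C + 1) ^ 2 * M) := by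
    field_simp
  rw [e]
  gcongr
  linarith

end BoundedDensity

/-! ### Calderón–Zygmund decomposition of a finite measure -/

section CalderonZygmund

variable {N : ℕ}

/-- A Calderón–Zygmund decomposition of `ν` at height `t`: countably many disjoint cells `Q i`,
each inside the ball of centre `c i` and radius `ρ i`, together with the good measure `g`, which
has bounded density, gives each cell its `ν`-mass, and agrees with `ν` off the cells. The bad part
`ν - g` thus has mean zero on every cell. -/
structure CZDecomposition (ν : Measure (RN N)) (t : ℝ) where
  /-- The index set of the cells. -/
  ι : Type
  countable : Countable ι
  /-- The centres of the balls. -/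
  c : ι → RN N
  /-- The radii of the balls. -/
  ρ : ι → ℝ
  /-- The cells. -/
  Q : ι → Set (RN N)
  /-- The good measure. -/
  g : Measure (RN N)
  radius_pos : ∀ i, 0 < ρ i
  measurableSet_cell : ∀ i, MeasurableSet (Q i)
  pairwise_disjoint : Pairwise (Function.onFun Disjoint Q)
  cell_subset : ∀ i, Q i ⊆ Metric.closedBall (c i) (ρ i)
  good_le : g ≤ ENNReal.ofReal (5 ^ N * t) • volume
  good_cell : ∀ i, g (Q i) = ν (Q i)
  good_restrict : g.restrict (⋃ i, Q i)ᶜ = ν.restrict (⋃ i, Q i)ᶜ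
  volume_balls_le : ∑' i, volume (Metric.closedBall (c i) (4 * ρ i)) ≤
    ENNReal.ofReal (20 ^ N / t) * ν univ

/-- Disjoint sets `B i ⊆ E i` can be enlarged to disjoint cells `Q i` with `B i ⊆ Q i ⊆ E i` that
cover all of `⋃ E i`. -/
theorem exists_disjoint_cells {α ι : Type*} [MeasurableSpace α] [Countable ι] {B E : ι → Set α}
    (hB : ∀ i, MeasurableSet (B i)) (hE : ∀ i, MeasurableSet (E i)) (hBE : ∀ i, B i ⊆ E i)
    (hd : Pairwise (Function.onFun Disjoint B)) :
    ∃ Q : ι → Set α, (∀ i, MeasurableSet (Q i)) ∧ Pairwise (Function.onFun Disjoint Q) ∧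
      (∀ i, B i ⊆ Q i) ∧ (∀ i, Q i ⊆ E i) ∧ ⋃ i, Q i = ⋃ i, E i := by
  have := Encodable.ofCountable ι
  let P : ι → Set α := fun i => E i \ ⋃ (j) (_ : j ≠ i), B j
  have hPm : ∀ i, MeasurableSet (P i) := fun i =>
    (hE i).diff (MeasurableSet.iUnion fun j => MeasurableSet.iUnion fun _ => hB j)
  have hBP : ∀ i, B i ⊆ P i := fun i x hx => by
    refine ⟨hBE i hx, fun hx' => ?_⟩
    simp only [mem_iUnion] at hx'
    obtain ⟨j, hji, hxj⟩ := hx'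
    exact (hd hji).le_bot ⟨hxj, hx⟩
  let Q : ι → Set α := fun i =>
    P i \ ⋃ (j) (_ : Encodable.encode j < Encodable.encode i), P j
  have hQP : ∀ i, Q i ⊆ P i := fun i => sdiff_subset
  refine ⟨Q, fun i => (hPm i).diff
    (MeasurableSet.iUnion fun j => MeasurableSet.iUnion fun _ => hPm j), ?_, ?_,
    fun i => (hQP i).trans sdiff_subset, ?_⟩
  · intro i j hij
    refine disjoint_left.2 fun x hxi hxj => ?_
    rcases lt_trichotomy (Encodable.encode i) (Encodable.encode j) with h | h | h
    · exact hxj.2 (mem_iUnion₂.2 ⟨i, h, hxi.1⟩)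
    · exact hij (Encodable.encode_injective h)
    · exact hxi.2 (mem_iUnion₂.2 ⟨j, h, hxj.1⟩)
  · intro i x hx
    refine ⟨hBP i hx, fun hx' => ?_⟩
    obtain ⟨j, hj, hxj⟩ := mem_iUnion₂.1 hx'
    refine hxj.2 (mem_iUnion₂.2 ⟨i, ?_, hx⟩)
    rintro rfl
    exact lt_irrefl _ hj
  · refine subset_antisymm (iUnion_mono fun i => (hQP i).trans sdiff_subset) ?_
    have hP : ⋃ i, E i ⊆ ⋃ i, P i := by
      refine iUnion_subset fun i x hx => ?_
      by_cases h : ∃ j, x ∈ B j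
      · obtain ⟨j, hj⟩ := h
        exact mem_iUnion.2 ⟨j, hBP j hj⟩
      · refine mem_iUnion.2 ⟨i, hx, fun hx' => ?_⟩
        obtain ⟨j, -, hj⟩ := mem_iUnion₂.1 hx'
        exact h ⟨j, hj⟩
    refine hP.trans fun x hx => ?_
    have hex : ∃ n, ∃ i, Encodable.encode i = n ∧ x ∈ P i := by
      obtain ⟨i, hi⟩ := mem_iUnion.1 hx
      exact ⟨_, i, rfl, hi⟩
    classical
    obtain ⟨i, hi, hxi⟩ := Nat.find_spec hex
    refine mem_iUnion.2 ⟨i, hxi, fun hx' => ?_⟩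
    obtain ⟨j, hj, hxj⟩ := mem_iUnion₂.1 hx'
    rw [hi] at hj
    exact Nat.find_min hex hj ⟨j, rfl, hxj⟩

/-- A measure whose density ratios on small balls are at most `t` at the points of `F` is at most
`t` times Lebesgue measure on subsets of `F`. -/
theorem measure_le_smul_volume_of_closedBall_le {ν : Measure (RN N)} [IsFiniteMeasure ν] {t : ℝ}
    {F : Set (RN N)} (h : ∀ x ∈ F, ∀ r, 0 < r →
      ν (Metric.closedBall x r) ≤ ENNReal.ofReal t * volume (Metric.closedBall x r)) :
    ν F ≤ ENNReal.ofReal t * volume F := by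
  have : IsLocallyFiniteMeasure (ENNReal.ofReal t • (volume : Measure (RN N))) :=
    inferInstanceAs (IsLocallyFiniteMeasure (Real.toNNReal t • (volume : Measure (RN N))))
  have := (Besicovitch.vitaliFamily ν).measure_le_of_frequently_le (ρ := ν)
    (ENNReal.ofReal t • volume) Measure.AbsolutelyContinuous.rfl F fun x hx => ?_
  · simpa using this
  · refine (Besicovitch.tendsto_filterAt ν x).frequently (Eventually.frequently ?_)
    filter_upwards [self_mem_nhdsWithin] with r hr
    exact h x hx r hr

/-- The points where some ball has density above `t` are covered by enlargements of disjoint such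
balls whose further enlargements have density at most `t`. -/
theorem exists_stopping_balls (hN : 0 < N) (ν : Measure (RN N)) [IsFiniteMeasure ν] {t : ℝ}
    (ht : 0 < t) :
    ∃ (u : Set (RN N)) (r : RN N → ℝ), u.Countable ∧ (∀ x ∈ u, 0 < r x) ∧
      u.PairwiseDisjoint (fun x => Metric.closedBall x (r x)) ∧
      (∀ x ∈ u, ENNReal.ofReal t * volume (Metric.closedBall x (r x)) ≤
        ν (Metric.closedBall x (r x))) ∧
      (∀ x ∈ u, ν (Metric.closedBall x (5 * r x)) ≤
        ENNReal.ofReal t * volume (Metric.closedBall x (5 * r x))) ∧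
      ∀ x ∉ ⋃ y ∈ u, Metric.closedBall y (5 * r y), ∀ s, 0 < s →
        ν (Metric.closedBall x s) ≤ ENNReal.ofReal t * volume (Metric.closedBall x s) := by
  have ht0 : ENNReal.ofReal t ≠ 0 := by simpa using ht
  obtain ⟨R, hR⟩ := exists_radius_bound hN
    (ENNReal.div_ne_top (measure_ne_top ν univ) ht0)
  let G : RN N → Set ℝ := fun x => {r | 0 < r ∧ ENNReal.ofReal t *
    volume (Metric.closedBall x r) < ν (Metric.closedBall x r)}
  have hGR : ∀ x, ∀ r ∈ G x, r ≤ R := fun x r hr => hR x r hr.1 <| by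
    rw [ENNReal.le_div_iff_mul_le (Or.inl ht0) (Or.inl ENNReal.ofReal_ne_top), mul_comm]
    exact hr.2.le.trans (measure_mono (subset_univ _))
  let D : Set (RN N) := {x | (G x).Nonempty}
  -- a radius beyond half the supremum makes every ball of twice the radius inadmissible
  have hsel : ∀ x ∈ D, ∃ r ∈ G x, ∀ s, 2 * r ≤ s → s ∉ G x := by
    intro x hx
    have hb : BddAbove (G x) := ⟨R, fun r hr => hGR x r hr⟩
    obtain ⟨r₀, hr₀⟩ := hx
    have hpos : 0 < sSup (G x) := hr₀.1.trans_le (le_csSup hb hr₀)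
    obtain ⟨r, hr, hlt⟩ := exists_lt_of_lt_csSup ⟨r₀, hr₀⟩ (half_lt_self hpos)
    refine ⟨r, hr, fun s hs hsG => ?_⟩
    have := le_csSup hb hsG
    linarith
  choose! r hrG hr2 using hsel
  obtain ⟨u, huD, huc, hud, hcov⟩ := exists_countable_vitali_selection (S := D) (r := r)
    (fun x hx => (hrG x hx).1) (fun x hx => hGR x _ (hrG x hx))
  refine ⟨u, r, huc, fun x hx => (hrG x (huD hx)).1, hud, fun x hx => (hrG x (huD hx)).2.le,
    fun x hx => ?_, fun x hx s hs => ?_⟩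
  · have hx0 := (hrG x (huD hx)).1
    by_contra! hcon
    exact hr2 x (huD hx) (5 * r x) (by linarith) ⟨by positivity, hcon⟩
  · by_contra! hcon
    exact hx (hcov ⟨s, hs, hcon⟩)

/-- The cells are built around the stopping balls. A cell contains its stopping ball and lies in the
enlarged one, so the average of `ν` over it is at most `5 ^ N * t`; off the cells `ν` itself has
density at most `t`. -/
theorem exists_czDecomposition (hN : 0 < N) (ν : Measure (RN N)) [IsFiniteMeasure ν] {t : ℝ}
    (ht : 0 < t) : Nonempty (CZDecomposition ν t) := by
  obtain ⟨u, r, huc, hr, hud, hlow, hup, hF⟩ := exists_stopping_balls hN ν ht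
  have := huc.to_subtype
  have ht0 : ENNReal.ofReal t ≠ 0 := by simpa using ht
  obtain ⟨Q, hQm, hQd, hBQ, hQE, hQU⟩ := exists_disjoint_cells (ι := u)
    (B := fun x => Metric.closedBall (x : RN N) (r x))
    (E := fun x => Metric.closedBall (x : RN N) (5 * r x))
    (fun x => Metric.isClosed_closedBall.measurableSet)
    (fun x => Metric.isClosed_closedBall.measurableSet)
    (fun x => Metric.closedBall_subset_closedBall (by linarith [hr x x.2]))
    (fun x y hxy => hud x.2 y.2 (Subtype.coe_injective.ne hxy))
  have hQ0 : ∀ x : u, volume (Q x) ≠ 0 := fun x => by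
    refine ((Metric.measure_ball_pos volume (x : RN N) (hr x x.2)).trans_le
      (measure_mono (Metric.ball_subset_closedBall.trans (hBQ x)))).ne'
  have hQt : ∀ x : u, volume (Q x) ≠ ∞ := fun x =>
    ((measure_mono (hQE x)).trans_lt measure_closedBall_lt_top).ne
  have hdens : ∀ x : u, ν (Q x) / volume (Q x) ≤ ENNReal.ofReal (5 ^ N * t) := by
    intro x
    refine ENNReal.div_le_of_le_mul ?_
    calc ν (Q x) ≤ ν (Metric.closedBall (x : RN N) (5 * r x)) := measure_mono (hQE x)
      _ ≤ ENNReal.ofReal t * volume (Metric.closedBall (x : RN N) (5 * r x)) := hup x x.2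
      _ = ENNReal.ofReal (5 ^ N * t) * volume (Metric.closedBall (x : RN N) (r x)) := by
          rw [volume_closedBall_mul (by norm_num) _ x.1 (hr x x.2).le,
            ENNReal.ofReal_mul (by positivity), ← mul_assoc, mul_comm (ENNReal.ofReal t)]
      _ ≤ _ := by
          gcongr
          exact hBQ x
  set U : Set (RN N) := ⋃ x, Q x with hU
  have hUm : MeasurableSet U := MeasurableSet.iUnion hQm
  have hνF : ∀ s : Set (RN N), ν (s ∩ Uᶜ) ≤ ENNReal.ofReal t * volume (s ∩ Uᶜ) := by
    intro s
    refine measure_le_smul_volume_of_closedBall_le fun x hx => hF x ?_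
    have := hx.2
    rw [hQU] at this
    rwa [biUnion_eq_iUnion]
  set g : Measure (RN N) := ν.restrict Uᶜ +
    Measure.sum fun x : u => (ν (Q x) / volume (Q x)) • volume.restrict (Q x) with hg
  have hQU' : ∀ x, Q x ⊆ U := subset_iUnion Q
  refine ⟨{
    ι := u, countable := ‹_›, c := fun x => x, ρ := fun x => 5 * r x, Q := Q, g := g,
    radius_pos := fun x => by linarith [hr x x.2],
    measurableSet_cell := hQm, pairwise_disjoint := hQd, cell_subset := hQE,
    good_le := ?_, good_cell := ?_, good_restrict := ?_, volume_balls_le := ?_ }⟩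
  · refine Measure.le_iff.2 fun s hs => ?_
    rw [hg, Measure.add_apply, Measure.restrict_apply hs, Measure.sum_apply _ hs,
      Measure.smul_apply, smul_eq_mul]
    have h1 : volume s = volume (s ∩ Uᶜ) + ∑' x : u, volume (s ∩ Q x) := by
      rw [← measure_iUnion (fun x y hxy => (hQd hxy).mono inter_subset_right inter_subset_right)
        (fun x => hs.inter (hQm x)), ← inter_iUnion, ← hU, add_comm, ← sdiff_eq,
        measure_inter_add_sdiff _ hUm]
    rw [h1, mul_add, ← ENNReal.tsum_mul_left]
    refine add_le_add ((hνF s).trans ?_) (ENNReal.tsum_le_tsum fun x => ?_)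
    · gcongr
      exact le_mul_of_one_le_left ht.le (one_le_pow₀ (by norm_num))
    · rw [Measure.smul_apply, Measure.restrict_apply hs, smul_eq_mul]
      gcongr
      exact hdens x
  · intro x
    rw [hg, Measure.add_apply, Measure.restrict_apply (hQm x), Measure.sum_apply _ (hQm x),
      tsum_eq_single x, Measure.smul_apply, Measure.restrict_apply (hQm x), inter_self,
      smul_eq_mul, ENNReal.div_mul_cancel (hQ0 x) (hQt x)]
    · have : Q x ∩ Uᶜ = ∅ := by
        rw [← sdiff_eq, sdiff_eq_empty]
        exact hQU' x
      rw [this, measure_empty, zero_add]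
    · intro y hy
      rw [Measure.smul_apply, Measure.restrict_apply (hQm x), (hQd hy.symm).inter_eq,
        measure_empty, smul_zero]
  · rw [hg, Measure.restrict_add, Measure.restrict_restrict hUm.compl, inter_self,
      Measure.restrict_sum _ hUm.compl]
    have : ∀ x : u, ((ν (Q x) / volume (Q x)) • volume.restrict (Q x)).restrict Uᶜ = 0 := by
      intro x
      rw [Measure.restrict_smul, Measure.restrict_restrict hUm.compl]
      have : Uᶜ ∩ Q x = ∅ := by
        rw [inter_comm, ← sdiff_eq, sdiff_eq_empty]
        exact hQU' x
      rw [this, Measure.restrict_empty, smul_zero]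
    simp only [this, Measure.sum_zero, add_zero]
    rw [hU]
  · calc ∑' x : u, volume (Metric.closedBall (x : RN N) (4 * (5 * r x)))
        = ∑' x : u, ENNReal.ofReal (20 ^ N / t) *
            (ENNReal.ofReal t * volume (Metric.closedBall (x : RN N) (r x))) := by
          refine tsum_congr fun x => ?_
          rw [← mul_assoc 4 5, volume_closedBall_mul (by norm_num) _ x.1 (hr x x.2).le,
            ← mul_assoc, ← ENNReal.ofReal_mul (by positivity), div_mul_cancel₀ _ ht.ne']
          norm_num
      _ ≤ ∑' x : u, ENNReal.ofReal (20 ^ N / t) * ν (Metric.closedBall (x : RN N) (r x)) := by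
          gcongr with x
          exact hlow x x.2
      _ = ENNReal.ofReal (20 ^ N / t) * ν (⋃ x : u, Metric.closedBall (x : RN N) (r x)) := by
          rw [ENNReal.tsum_mul_left, measure_iUnion (ι := u)
            (fun x y hxy => hud x.2 y.2 (Subtype.coe_injective.ne hxy))
            fun x => Metric.isClosed_closedBall.measurableSet]
      _ ≤ _ := by
          gcongr
          exact subset_univ _

end CalderonZygmund

/-! ### The bad part of the potential -/

section BadPart

variable {N : ℕ} {A t : ℝ} {K : RN N → ℝ} {ν : Measure (RN N)}

/-- The mixed difference of the kernel at two arbitrarily distant points: close points are handled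
by the second-order bound, distant ones by the first-order bound at each of them. -/
theorem HasKernelBounds.abs_mixed_difference_le (hN : 0 < N) (hK : HasKernelBounds A K)
    {z z' b : RN N} (hz : z ≠ 0) (hz' : z' ≠ 0) (hb : ‖b‖ ≤ ‖z‖ / 4) (hb' : ‖b‖ ≤ ‖z'‖ / 4) :
    |K (z + b) - K z - (K (z' + b) - K z')| ≤
      5 * A * ‖z - z'‖ * ‖b‖ * ((‖z‖ ^ (N + 1))⁻¹ + (‖z'‖ ^ (N + 1))⁻¹) := by
  have hA := hK.nonneg hN
  have hz0 := norm_pos_iff.2 hz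
  have hz0' := norm_pos_iff.2 hz'
  by_cases hc : ‖z' - z‖ ≤ ‖z‖ / 4
  · have h := hK.mixed z (z' - z) b hz (by linarith)
    rw [add_sub_cancel, abs_sub_comm, norm_sub_rev] at h
    refine h.trans ?_
    rw [mul_add, div_eq_mul_inv]
    refine le_add_of_le_of_nonneg ?_ (by positivity)
    gcongr
    linarith
  · have hd : ‖z' - z‖ = ‖z - z'‖ := norm_sub_rev _ _
    have hn : ‖z'‖ ≤ ‖z' - z‖ + ‖z‖ := by simpa using norm_add_le (z' - z) z
    have key : ∀ w : RN N, w ≠ 0 → ‖b‖ ≤ ‖w‖ / 4 → ‖w‖ ≤ 5 * ‖z - z'‖ →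
        |K (w + b) - K w| ≤ 5 * A * ‖z - z'‖ * ‖b‖ * (‖w‖ ^ (N + 1))⁻¹ := by
      intro w hw hbw hle
      have hw0 := norm_pos_iff.2 hw
      calc |K (w + b) - K w| ≤ A * ‖b‖ / ‖w‖ ^ N := hK.first w b hw (by linarith)
        _ = A * ‖b‖ * ‖w‖ * (‖w‖ ^ (N + 1))⁻¹ := by
            rw [pow_succ]
            field_simp
        _ ≤ A * ‖b‖ * (5 * ‖z - z'‖) * (‖w‖ ^ (N + 1))⁻¹ := by gcongr
        _ = _ := by ring
    rw [mul_add]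
    refine (abs_sub _ _).trans (add_le_add (key z hz hb ?_) (key z' hz' hb' ?_)) <;> linarith

namespace CZDecomposition

variable (D : CZDecomposition ν t)

theorem good_univ : D.g univ = ν univ := by
  have := D.countable
  have hU : MeasurableSet (⋃ i, D.Q i) := MeasurableSet.iUnion D.measurableSet_cell
  have h1 : D.g (⋃ i, D.Q i)ᶜ = ν (⋃ i, D.Q i)ᶜ := by
    simpa using congrArg (fun m : Measure (RN N) => m univ) D.good_restrict
  rw [← measure_add_measure_compl hU, ← measure_add_measure_compl (μ := ν) hU, h1,
    measure_iUnion D.pairwise_disjoint D.measurableSet_cell,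
    measure_iUnion D.pairwise_disjoint D.measurableSet_cell]
  simp only [D.good_cell]

theorem isFiniteMeasure_good [IsFiniteMeasure ν] : IsFiniteMeasure D.g :=
  ⟨D.good_univ ▸ measure_lt_top ν univ⟩

/-- The exceptional set: the union of the enlarged balls of the decomposition. -/
def exceptional : Set (RN N) := ⋃ i, Metric.closedBall (D.c i) (4 * D.ρ i)

/-- The Marcinkiewicz-type function `∑ᵢ ρᵢ ν(Qᵢ) / |x - cᵢ|ᴺ⁺¹`, which controls the local Lipschitz
constant of the bad part of the potential off the exceptional set. -/
noncomputable def marcinkiewicz (x : RN N) : ℝ≥0∞ :=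
  ∑' i, ENNReal.ofReal (D.ρ i * (‖x - D.c i‖ ^ (N + 1))⁻¹) * ν (D.Q i)

theorem volume_exceptional_le : volume D.exceptional ≤ ENNReal.ofReal (20 ^ N / t) * ν univ := by
  have := D.countable
  exact (measure_iUnion_le _).trans D.volume_balls_le

theorem measurable_marcinkiewicz : Measurable D.marcinkiewicz := by
  have := D.countable
  unfold marcinkiewicz
  fun_prop

theorem measurableSet_exceptional : MeasurableSet D.exceptional := by
  have := D.countable
  exact MeasurableSet.iUnion fun i => Metric.isClosed_closedBall.measurableSet

theorem lintegral_marcinkiewicz_le [Nontrivial (RN N)] (hN : 0 < N) :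
    ∫⁻ x in D.exceptionalᶜ, D.marcinkiewicz x ≤ ENNReal.ofReal (sphereArea N) * ν univ := by
  have := D.countable
  unfold marcinkiewicz
  rw [lintegral_tsum (fun i => by fun_prop)]
  have hterm : ∀ i, ∫⁻ x in D.exceptionalᶜ,
      ENNReal.ofReal (D.ρ i * (‖x - D.c i‖ ^ (N + 1))⁻¹) * ν (D.Q i) ≤
        ENNReal.ofReal (sphereArea N) * ν (D.Q i) := by
    intro i
    have hρ := D.radius_pos i
    have hS := sphereArea_nonneg N
    rw [lintegral_mul_const _ (by fun_prop)]
    refine mul_le_mul' ?_ le_rfl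
    set B := (Metric.ball (0 : RN N) (4 * D.ρ i))ᶜ with hB
    have hBm : MeasurableSet B := Metric.isOpen_ball.measurableSet.compl
    calc ∫⁻ x in D.exceptionalᶜ, ENNReal.ofReal (D.ρ i * (‖x - D.c i‖ ^ (N + 1))⁻¹)
        ≤ ∫⁻ x, B.indicator (fun z => ENNReal.ofReal (D.ρ i * (‖z‖ ^ (N + 1))⁻¹)) (x - D.c i) := by
          rw [← lintegral_indicator D.measurableSet_exceptional.compl]
          refine lintegral_mono fun x => ?_
          by_cases hx : x ∈ D.exceptionalᶜ
          · have hxB : x - D.c i ∈ B := by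
              intro hmem
              refine hx (mem_iUnion.2 ⟨i, Metric.ball_subset_closedBall ?_⟩)
              simpa [dist_eq_norm] using hmem
            rw [indicator_of_mem hx, indicator_of_mem hxB]
          · rw [indicator_of_notMem hx]
            exact zero_le
      _ = ENNReal.ofReal (D.ρ i) * ∫⁻ z in B, ENNReal.ofReal ((‖z‖ ^ (N + 1))⁻¹) := by
          rw [lintegral_sub_right_eq_self
            (B.indicator fun z => ENNReal.ofReal (D.ρ i * (‖z‖ ^ (N + 1))⁻¹)),
            lintegral_indicator hBm, ← lintegral_const_mul _ (by fun_prop)]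
          simp only [ENNReal.ofReal_mul hρ.le]
      _ = ENNReal.ofReal (sphereArea N / 4) := by
          rw [lintegral_compl_ball_inv_norm_pow hN (by positivity), ← ENNReal.ofReal_mul hρ.le]
          congr 1
          field_simp
      _ ≤ ENNReal.ofReal (sphereArea N) := ENNReal.ofReal_le_ofReal (by linarith)
  calc _ ≤ ∑' i, ENNReal.ofReal (sphereArea N) * ν (D.Q i) := ENNReal.tsum_le_tsum hterm
    _ = ENNReal.ofReal (sphereArea N) * ν (⋃ i, D.Q i) := by
        rw [ENNReal.tsum_mul_left, measure_iUnion D.pairwise_disjoint D.measurableSet_cell]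
    _ ≤ _ := by
        gcongr
        exact subset_univ _

/-- A finite measure and its good part have nearly the same potential differences off the
exceptional set: the cancellation on each cell allows the kernel to be replaced by its increment
from the centre of the cell. -/
theorem enorm_integral_sub_integral_good_le [IsFiniteMeasure ν] (hN : 0 < N)
    (hK : HasKernelBounds A K) {x x' : RN N} (hx : x ∉ D.exceptional) (hx' : x' ∉ D.exceptional)
    (hν : Integrable (fun y => K (x - y) - K (x' - y)) ν)
    (hg : Integrable (fun y => K (x - y) - K (x' - y)) D.g) :
    ‖(∫ y, (K (x - y) - K (x' - y)) ∂ν) - ∫ y, (K (x - y) - K (x' - y)) ∂D.g‖ₑ ≤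
      ENNReal.ofReal (10 * A * ‖x - x'‖) * (D.marcinkiewicz x + D.marcinkiewicz x') := by
  have hA := hK.nonneg hN
  have := D.countable
  have := D.isFiniteMeasure_good
  set W : RN N → ℝ := fun y => K (x - y) - K (x' - y) with hW
  set U := ⋃ i, D.Q i with hU
  have hUm : MeasurableSet U := MeasurableSet.iUnion D.measurableSet_cell
  have hfar : ∀ w, w ∉ D.exceptional → ∀ i, 4 * D.ρ i < ‖w - D.c i‖ := by
    intro w hw i
    by_contra! hcon
    exact hw (mem_iUnion.2 ⟨i, by simpa [dist_eq_norm] using hcon⟩)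
  have hsum := (hasSum_integral_iUnion D.measurableSet_cell D.pairwise_disjoint
    hν.integrableOn).sub (hasSum_integral_iUnion D.measurableSet_cell D.pairwise_disjoint
    hg.integrableOn)
  have hdiff : (∫ y, W y ∂ν) - ∫ y, W y ∂D.g = (∫ y in U, W y ∂ν) - ∫ y in U, W y ∂D.g := by
    rw [← integral_add_compl hUm hν, ← integral_add_compl hUm hg, D.good_restrict]
    ring
  rw [hdiff, ← hsum.tsum_eq]
  refine (enorm_tsum_le_tsum_enorm).trans ?_
  unfold marcinkiewicz
  rw [← ENNReal.tsum_add, ← ENNReal.tsum_mul_left]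
  refine ENNReal.tsum_le_tsum fun i => ?_
  have hρ := D.radius_pos i
  set w := K (x - D.c i) - K (x' - D.c i) with hw
  set b := 5 * A * ‖x - x'‖ * D.ρ i *
    ((‖x - D.c i‖ ^ (N + 1))⁻¹ + (‖x' - D.c i‖ ^ (N + 1))⁻¹) with hb
  have hpt : ∀ y ∈ D.Q i, ‖W y - w‖ₑ ≤ ENNReal.ofReal b := by
    intro y hy
    have hyc : ‖D.c i - y‖ ≤ D.ρ i := by
      simpa [dist_eq_norm, norm_sub_rev] using D.cell_subset i hy
    have h1 := hfar x hx i
    have h2 := hfar x' hx' i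
    have h := hK.abs_mixed_difference_le hN (z := x - D.c i) (z' := x' - D.c i) (b := D.c i - y)
      (norm_pos_iff.1 (by linarith)) (norm_pos_iff.1 (by linarith)) (by linarith) (by linarith)
    rw [sub_add_sub_cancel, sub_add_sub_cancel, sub_sub_sub_cancel_right] at h
    rw [Real.enorm_eq_ofReal_abs]
    refine ENNReal.ofReal_le_ofReal ?_
    rw [hW, hw, sub_sub_sub_comm]
    exact h.trans (by rw [hb]; gcongr)
  have hcell : ∀ m : Measure (RN N), IsFiniteMeasure m → m (D.Q i) = ν (D.Q i) →
      ‖∫ y in D.Q i, (W y - w) ∂m‖ₑ ≤ ENNReal.ofReal b * ν (D.Q i) := by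
    intro m _ hm
    refine (enorm_integral_le_lintegral_enorm _).trans
      ((setLIntegral_mono' (D.measurableSet_cell i) hpt).trans ?_)
    rw [setLIntegral_const, hm]
  have hsplit : (∫ y in D.Q i, W y ∂ν) - ∫ y in D.Q i, W y ∂D.g =
      (∫ y in D.Q i, (W y - w) ∂ν) - ∫ y in D.Q i, (W y - w) ∂D.g := by
    rw [integral_sub hν.integrableOn (integrable_const w), integral_sub hg.integrableOn
      (integrable_const w), setIntegral_const, setIntegral_const, measureReal_def,
      measureReal_def, D.good_cell]
    ring
  calc _ ≤ ENNReal.ofReal b * ν (D.Q i) + ENNReal.ofReal b * ν (D.Q i) := by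
        rw [hsplit]
        exact (enorm_sub_le).trans
          (add_le_add (hcell ν inferInstance rfl) (hcell D.g inferInstance (D.good_cell i)))
    _ = _ := by
        rw [← add_mul, ← add_mul, ← ENNReal.ofReal_add (by positivity) (by positivity),
          ← ENNReal.ofReal_add (by positivity) (by positivity), ← mul_assoc,
          ← ENNReal.ofReal_mul (by positivity)]
        congr 2
        rw [hb]
        ring

end CZDecomposition

/-- **Lusin–Lipschitz estimate** for the potential of a finite positive measure: off a set of
measure `O(ν(ℝᴺ) / t)` the potential is `t`-Lipschitz where it is defined. -/
theorem exists_potential_lipschitz [Nontrivial (RN N)] (hN : 0 < N) (hA : 0 ≤ A) :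
    ∃ C : ℝ, 0 < C ∧ ∀ K : RN N → ℝ, HasKernelBounds A K → ∀ ν : Measure (RN N),
      IsFiniteMeasure ν → ∀ t : ℝ, 0 < t → ∃ E : Set (RN N),
        volume Eᶜ ≤ ENNReal.ofReal (C / t) * ν univ ∧
        ∀ x ∈ E, ∀ x' ∈ E, Integrable (fun y => K (x - y)) ν →
          Integrable (fun y => K (x' - y)) ν →
          |(∫ y, K (x - y) ∂ν) - ∫ y, K (x' - y) ∂ν| ≤ t * ‖x - x'‖ := by
  have hS := sphereArea_nonneg N
  have hd : 0 ≤ differenceConst N A := by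
    unfold differenceConst
    positivity
  have hz : 0 ≤ zygmundConst N := by unfold zygmundConst; positivity
  -- the Lipschitz constant produced by the decomposition at height `s` is `L * s`
  set L : ℝ := 8 * ((differenceConst N A + 1) * 5 ^ N) + 20 * A with hL
  have hL0 : 0 < L := by positivity
  set C₁ : ℝ := 20 ^ N + sphereArea N + zygmundConst N / 5 ^ N with hC₁
  have hC₁0 : 0 < C₁ := by positivity
  refine ⟨C₁ * L, by positivity, fun K hK ν _ t ht => ?_⟩
  set s := t / L with hs
  have hs0 : 0 < s := by positivity
  obtain ⟨D⟩ := exists_czDecomposition hN ν hs0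
  have := D.isFiniteMeasure_good
  -- the density bound of the good measure
  set M := 5 ^ N * s with hM
  have hM0 : 0 < M := by positivity
  set H := {x | x ∉ D.exceptional ∧ ENNReal.ofReal s ≤ D.marcinkiewicz x} with hH
  set Z := {x | ∃ y, 8 * ((differenceConst N A + 1) * M) * ‖y - x‖ <
        |(∫ z, K (y - z) ∂D.g) - ∫ z, K (x - z) ∂D.g|} with hZ
  have hHv : volume H ≤ ENNReal.ofReal (sphereArea N / s) * ν univ := by
    have h1 : ENNReal.ofReal s * volume H ≤ ENNReal.ofReal (sphereArea N) * ν univ := by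
      refine le_trans ?_ (D.lintegral_marcinkiewicz_le hN)
      refine le_trans (le_of_eq ?_) (mul_meas_ge_le_lintegral D.measurable_marcinkiewicz
        (ENNReal.ofReal s))
      rw [Measure.restrict_apply (measurableSet_le measurable_const D.measurable_marcinkiewicz),
        inter_comm]
      rfl
    rw [ENNReal.ofReal_div_of_pos hs0, ENNReal.mul_div_right_comm.symm]
    rwa [ENNReal.le_div_iff_mul_le (Or.inl (by simpa using hs0)) (Or.inl ENNReal.ofReal_ne_top),
      mul_comm]
  refine ⟨(D.exceptional ∪ H ∪ Z)ᶜ, ?_, ?_⟩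
  · rw [compl_compl]
    calc volume (D.exceptional ∪ H ∪ Z)
        ≤ volume D.exceptional + volume H + volume Z :=
          (measure_union_le _ _).trans (add_le_add (measure_union_le _ _) le_rfl)
      _ ≤ ENNReal.ofReal (20 ^ N / s) * ν univ + ENNReal.ofReal (sphereArea N / s) * ν univ +
          ENNReal.ofReal (zygmundConst N / M) * ν univ := by
          refine add_le_add (add_le_add D.volume_exceptional_le hHv) ?_
          rw [← D.good_univ]
          exact hK.volume_potential_large_difference_le hN hM0 D.good_le
      _ = ENNReal.ofReal (C₁ * L / t) * ν univ := by
          rw [← add_mul, ← add_mul, ← ENNReal.ofReal_add (by positivity) (by positivity),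
            ← ENNReal.ofReal_add (by positivity) (by positivity)]
          congr 2
          rw [hC₁, hM, hs]
          field_simp
  · intro x hx x' hx' hi hi'
    simp only [mem_compl_iff, mem_union, not_or] at hx hx'
    have hm : ∀ w, w ∉ D.exceptional → w ∉ H → D.marcinkiewicz w ≤ ENNReal.ofReal s := by
      intro w hw hwH
      by_contra! hcon
      exact hwH ⟨hw, hcon.le⟩
    have hgi := hK.integrable_of_le_smul hN D.good_le
    have hbad := D.enorm_integral_sub_integral_good_le hN hK hx.1.1 hx'.1.1 (hi.sub hi')
      ((hgi x).sub (hgi x'))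
    rw [integral_sub hi hi', integral_sub (hgi x) (hgi x'), Real.enorm_eq_ofReal_abs] at hbad
    have hbad' := hbad.trans (mul_le_mul' le_rfl
      (add_le_add (hm x hx.1.1 hx.1.2) (hm x' hx'.1.1 hx'.1.2)))
    rw [← ENNReal.ofReal_add hs0.le hs0.le, ← ENNReal.ofReal_mul (by positivity),
      ENNReal.ofReal_le_ofReal_iff (by positivity)] at hbad'
    have hgood : |(∫ z, K (x - z) ∂D.g) - ∫ z, K (x' - z) ∂D.g| ≤
        8 * ((differenceConst N A + 1) * M) * ‖x - x'‖ := by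
      by_contra! hcon
      exact hx'.2 ⟨x, hcon⟩
    have hLt : t = L * s := by
      rw [hs]
      field_simp
    have key := (abs_add_le _ _).trans (add_le_add hbad' hgood)
    refine le_trans (le_of_eq ?_) (key.trans (le_of_eq ?_))
    · congr 1
      ring
    · rw [hLt, hL, hM]
      ring

end BadPart

/-! ### Potentials of signed measures -/

section SignedPotential

variable {N : ℕ} {A : ℝ} {K : RN N → ℝ}

theorem HasKernelBounds.ae_lintegral_lt_top [Nontrivial (RN N)] (hN : 0 < N)
    (hK : HasKernelBounds A K) (ν : Measure (RN N)) [IsFiniteMeasure ν] :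
    ∀ᵐ x, ∫⁻ y, ‖K (x - y)‖ₑ ∂ν < ∞ := by
  have hA := hK.nonneg hN
  have hKm := hK.measurable
  set B := Metric.ball (0 : RN N) 1 with hB
  have hBm : MeasurableSet B := Metric.isOpen_ball.measurableSet
  set F : RN N → ℝ≥0∞ := B.indicator fun z => ‖K z‖ₑ with hF
  have hFm : Measurable F := hKm.enorm.indicator hBm
  -- the singular part of the kernel is integrable, so Tonelli's theorem applies to it
  have hfin : ∫⁻ x, ∫⁻ y, F (x - y) ∂ν ≠ ∞ := by
    rw [lintegral_lintegral_swap (by fun_prop)]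
    have : ∀ y, ∫⁻ x, F (x - y) ≤ ENNReal.ofReal (A * sphereArea N * 1) := fun y => by
      rw [lintegral_sub_right_eq_self F, hF, lintegral_indicator hBm]
      exact lintegral_ball_enorm_le hA hK.size zero_le_one
    refine ((lintegral_mono this).trans_lt ?_).ne
    rw [lintegral_const]
    exact ENNReal.mul_lt_top ENNReal.ofReal_lt_top (measure_lt_top _ _)
  filter_upwards [ae_lt_top (Measurable.lintegral_prod_right'
    (f := fun p : RN N × RN N => F (p.1 - p.2)) (by fun_prop)) hfin] with x hx
  refine (lintegral_mono fun y => hK.enorm_le_indicator_ball_add hN (x - y)).trans_lt ?_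
  rw [lintegral_add_right _ measurable_const, lintegral_const]
  exact ENNReal.add_lt_top.2 ⟨hx, ENNReal.mul_lt_top ENNReal.ofReal_lt_top (measure_lt_top _ _)⟩

theorem variation_eq_posPart_add_negPart (μ : SignedMeasure (RN N)) :
    μ.variation = μ.toJordanDecomposition.posPart + μ.toJordanDecomposition.negPart := by
  rw [← SignedMeasure.totalVariation_eq_variation]
  rfl

instance isFiniteMeasure_variation (μ : SignedMeasure (RN N)) : IsFiniteMeasure μ.variation := by
  rw [variation_eq_posPart_add_negPart]
  infer_instance

/-- On its domain, the convolution with a signed measure is the difference of the potentials of the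
positive and negative parts of the measure. -/
theorem convMeasure_eq_sub (hK : Measurable K) (μ : SignedMeasure (RN N)) {x : RN N}
    (hx : x ∈ convDom K μ) :
    Integrable (fun y => K (x - y)) μ.toJordanDecomposition.posPart ∧
      Integrable (fun y => K (x - y)) μ.toJordanDecomposition.negPart ∧
      convMeasure K μ x = (∫ y, K (x - y) ∂μ.toJordanDecomposition.posPart) -
        ∫ y, K (x - y) ∂μ.toJordanDecomposition.negPart := by
  have hi : Integrable (fun y => K (x - y)) μ.variation :=
    ⟨(hK.comp (measurable_const_sub x)).aestronglyMeasurable, hasFiniteIntegral_iff_enorm.2 hx⟩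
  rw [variation_eq_posPart_add_negPart, integrable_add_measure] at hi
  refine ⟨hi.1, hi.2, ?_⟩
  unfold convMeasure
  conv_lhs => rw [← SignedMeasure.toSignedMeasure_toJordanDecomposition μ]
  rw [JordanDecomposition.toSignedMeasure, VectorMeasure.integral_sub_vectorMeasure,
    VectorMeasure.integral_toSignedMeasure, VectorMeasure.integral_toSignedMeasure]
  · rw [VectorMeasure.Integrable, Measure.variation_toSignedMeasure]
    exact hi.1
  · rw [VectorMeasure.Integrable, Measure.variation_toSignedMeasure]
    exact hi.2

/-- **Lusin–Lipschitz estimate** for the convolution of a kernel with a signed measure. -/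
theorem exists_convMeasure_lipschitzOnWith [Nontrivial (RN N)] (hN : 0 < N) (hA : 0 ≤ A) :
    ∃ C : ℝ, 0 < C ∧ ∀ K : RN N → ℝ, HasKernelBounds A K → ∀ μ : SignedMeasure (RN N),
      ∀ t : NNReal, 0 < t → ∃ E : Set (RN N),
        volume Eᶜ ≤ ENNReal.ofReal C * μ.variation univ / t ∧
        LipschitzOnWith t (convMeasure K μ) E := by
  obtain ⟨C, hC, h⟩ := exists_potential_lipschitz (N := N) hN hA
  refine ⟨2 * C, by positivity, fun K hK μ t ht => ?_⟩
  have ht' : (0 : ℝ) < t := ht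
  have ht2 : (0 : ℝ) < t / 2 := by positivity
  set p := μ.toJordanDecomposition.posPart
  set n := μ.toJordanDecomposition.negPart
  obtain ⟨E₁, hE₁, hL₁⟩ := h K hK p inferInstance _ ht2
  obtain ⟨E₂, hE₂, hL₂⟩ := h K hK n inferInstance _ ht2
  have hdom : volume (convDom K μ)ᶜ = 0 := hK.ae_lintegral_lt_top hN μ.variation
  refine ⟨convDom K μ ∩ (E₁ ∩ E₂), ?_, ?_⟩
  · rw [compl_inter, compl_inter]
    calc volume ((convDom K μ)ᶜ ∪ (E₁ᶜ ∪ E₂ᶜ))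
        ≤ 0 + (ENNReal.ofReal (C / (t / 2)) * p univ + ENNReal.ofReal (C / (t / 2)) * n univ) :=
          (measure_union_le _ _).trans (add_le_add hdom.le
            ((measure_union_le _ _).trans (add_le_add hE₁ hE₂)))
      _ = ENNReal.ofReal (2 * C) * μ.variation univ / t := by
          rw [zero_add, ← mul_add, variation_eq_posPart_add_negPart, Measure.add_apply,
            ENNReal.mul_div_right_comm, ← ENNReal.ofReal_coe_nnreal,
            ← ENNReal.ofReal_div_of_pos ht']
          congr 2
          field_simp
  · refine LipschitzOnWith.of_dist_le_mul fun x hx y hy => ?_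
    obtain ⟨hxp, hxn, hxe⟩ := convMeasure_eq_sub hK.measurable μ hx.1
    obtain ⟨hyp, hyn, hye⟩ := convMeasure_eq_sub hK.measurable μ hy.1
    have h1 := hL₁ x hx.2.1 y hy.2.1 hxp hyp
    have h2 := hL₂ x hx.2.2 y hy.2.2 hxn hyn
    rw [Real.dist_eq, dist_eq_norm, hxe, hye, sub_sub_sub_comm]
    refine (abs_sub _ _).trans ((add_le_add h1 h2).trans (le_of_eq ?_))
    ring

end SignedPotential

theorem mainTheorem4 (N : ℕ) (hN : 2 ≤ N) (A B : ℝ) (hA : 0 < A) (hB : 0 < B) :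
    ∃ C : ℝ, 0 < C ∧
      ∀ K : RN N → ℝ, IsAdmissibleKernel A B K →
      ∀ μ : SignedMeasure (RN N),
        (∀ᵐ y : RN N, y ∈ convDom K μ ∧ ApDifferentiableAt (convMeasure K μ) y) ∧
        AEStronglyMeasurable (apDeriv (convMeasure K μ)) volume ∧
        weakL1Quasinorm (apDeriv (convMeasure K μ)) ≤
          ENNReal.ofReal C * μ.variation univ := by
  have hN0 : 0 < N := by omega
  have : Nonempty (Fin N) := ⟨⟨0, hN0⟩⟩
  have : Nontrivial (RN N) := inferInstance
  obtain ⟨C, hC, h⟩ := exists_convMeasure_lipschitzOnWith (N := N)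
    (A := (A * 2 ^ (N + 1) + B * 2 ^ (N + 1)) * 2 ^ N) hN0 (by positivity)
  refine ⟨C, hC, fun K hK μ => ?_⟩
  have hKb := hK.hasKernelBounds hN0 hA.le hB.le
  obtain ⟨h1, h2, h3⟩ := apDeriv_of_lusin_lipschitz hN0
    (ENNReal.mul_ne_top ENNReal.ofReal_ne_top (measure_ne_top μ.variation univ)) (h K hKb μ)
  exact ⟨(hKb.ae_lintegral_lt_top hN0 μ.variation).and h1, h2, h3⟩
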